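/- Let $n\ge 2$, let $\beta=(\beta_1,\dots,\beta_n)\in\mathbb{N}_0^n$ with $|\beta|=\beta_1+\dots+\beta_n\ge 1$, and write $\partial^\beta=\partial_{x_1}^{\beta_1}\cdots\partial_{x_n}^{\beta_n}$. Let $A,d\in\mathbb{N}_0$ and let $N_2>\beta_2,\dots,N_n>\beta_n$ be integers; in the single case $\beta=(1,0,\dots,0)$ let also an integer $N_1>1$ be given. A function is called single-signed on $X$ if it is $\ge 0$ on all of $X$ or $\le 0$ on all of $X$. A real polynomial $Q(x)=a_mx^m+\dots+a_0$ of degree $m$ is called semi-non-degenerating (SND) if $\max_j|a_{m-j}|=1$ and this maximum is attained for some $j\le m/2$. Then there is a function $C:\mathbb{R}\to\mathbb{R}$, depending only on $n,\beta,d,A$ and the $N_j$, and bounded above on $[0,R]$ for every $R$, with the following property. Let $X\subseteq\mathbb{R}^n$ be a bounded, (Lebesgue) measurable set such that for each $j\in\{2,\dots,n\}$, and also for $j=1$ if $\beta_1\ge 1$, and for all real $x_i$ ($i\ne j$), the slice $$\{y\in\mathbb{R}:(x_1,\dots,x_{j-1},y,x_{j+1},\dots,x_n)\in X\}$$ is a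 union of at most $A$ intervals. Let $f$ be a smooth real-valued function on an open neighbourhood of $X$ with $|\partial^\beta f|\ge 1$ on $X$, such that for each $j\in\{2,\dots,n\}$ the derivative $\partial^{(0,\dots,0,N_j,\beta_{j+1},\dots,\beta_n)}f$ (with $N_j$ in the $j$-th position) is single-signed on $X$; in the case $\beta=(1,0,\dots,0)$ assume in addition that $\partial_{x_1}^{N_1}f$ is single-signed on $X$. Then for every real polynomial $P$ of degree $d$ such that $P'$ is monic or SND, and every real $\lambda\ne 0$, $$\left|\int_X e^{i\lambda P(f(x))}\,dx\right|\le C(\operatorname{diam}X)\,|\lambda|^{-1/(|\beta|d)}.$$ -/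

import Mathlib

open scoped ContDiff

noncomputable section

namespace PolyPhase

/-- The partial derivative `∂_{x_j} f`. -/
def pderiv {n : ℕ} (j : Fin n) (f : EuclideanSpace ℝ (Fin n) → ℝ) :
    EuclideanSpace ℝ (Fin n) → ℝ :=
  fun x => fderiv ℝ f x (EuclideanSpace.single j 1)

/-- The mixed derivative `∂^β f = ∂_{x_1}^{β_1} (∂_{x_2}^{β_2} (⋯ ∂_{x_n}^{β_n} f))`. -/
def mderiv {n : ℕ} (β : Fin n → ℕ) (f : EuclideanSpace ℝ (Fin n) → ℝ) :
    EuclideanSpace ℝ (Fin n) → ℝ :=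
  (List.finRange n).foldr (fun j g => (pderiv j)^[β j] g) f

/-- The multiindex `(0, …, 0, N_j, β_{j+1}, …, β_n)`, with `N_j` in position `j`. -/
def tailIndex {n : ℕ} (β N : Fin n → ℕ) (j : Fin n) : Fin n → ℕ :=
  fun i => if i < j then 0 else if i = j then N j else β i

/-- `g ≥ 0` throughout `X`, or `g ≤ 0` throughout `X`. -/
def SingleSignedOn {E : Type*} (g : E → ℝ) (X : Set E) : Prop :=
  (∀ x ∈ X, 0 ≤ g x) ∨ (∀ x ∈ X, g x ≤ 0)

/-- `S` is a union of at most `A` intervals (of any kind: open, closed, half-open, degenerate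
to a point, or empty). -/
def IsUnionOfIntervals (A : ℕ) (S : Set ℝ) : Prop :=
  ∃ I : Fin A → Set ℝ, (∀ k, (I k).OrdConnected) ∧ S = ⋃ k, I k

/-- Every one-dimensional slice of `X` parallel to the `j`-th coordinate axis is a union of at
most `A` intervals. -/
def SlicesIn {n : ℕ} (j : Fin n) (A : ℕ) (X : Set (EuclideanSpace ℝ (Fin n))) : Prop :=
  ∀ x : Fin n → ℝ, IsUnionOfIntervals A {y : ℝ | WithLp.toLp 2 (Function.update x j y) ∈ X}

/-- Semi-non-degenerating polynomials: for `Q` of degree `d`, the largest absolute value of a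
coefficient is `1`, and it is attained at `x ^ (d - j)` for some `j ≤ d / 2`. -/
def IsSND (Q : Polynomial ℝ) : Prop :=
  (∀ i, |Q.coeff i| ≤ 1) ∧ ∃ j : ℕ, 2 * j ≤ Q.natDegree ∧ |Q.coeff (Q.natDegree - j)| = 1

end PolyPhase

end

/-! Write `b = |β|`, `d = m + 1`, `Q = P'` and `μ = |λ|^(-1/(b d))`; the goal is a bound of order
`μ`. For `|λ| ≤ 1` one has `μ ≥ 1` and the volume of a box containing `X` suffices. For `|λ| > 1`,
let `k` be the last index with `β k ≠ 0` and split `X` according to the sizes of `∂_k f` and `Q(f)`,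
with thresholds `η = μ^(b-1)` and `s = c μ^(b m)`.

Where both are large, the phase has `x_k`-derivative at least `|λ| s η = c / μ`. The sign hypotheses
cut each line in direction `k` into boundedly many intervals on which the factors of this derivative
are monotone, so the first-derivative van der Corput estimate gives `O(μ)` on each line
(`slice_oscillatory`), and Fubini concludes.

Where `∂_k f` is small, a sublevel estimate applies with `β` lowered by one in position `k`. Where
`Q(f)` is small, `f` lies in one of at most `2^(m+1)` intervals of length at most `μ^b`. This is
what monic or SND provides: a Taylor coefficient bounded below at every point
(`exists_le_abs_taylor_coeff`) makes `|Q|` large somewhere on each interval of given length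
(`exists_le_abs_eval`). The sublevel estimate for `f - t₀` then gives `O(μ)` for each such interval.

The sublevel estimate `|{|g| < δ}| = O(δ^(1/b))` (`sublevel_estimate`) strips `∂^β g` of one
coordinate direction at a time. If `|∂^β g| ≥ 1` but `|g| < δ`, then at some direction the function
drops below its threshold while its derivative of order `β j` does not. A one-variable estimate
controls each such drop, and the thresholds are geometric so that every drop costs `δ^(1/b)`. -/

namespace PolyPhase

open Set MeasureTheory

/-! ### Decompositions into boundedly many intervals -/

/-- `Decomp p K S`: the set `S` is a disjoint union of at most `K` order-connected sets, each
satisfying `p`. -/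
inductive Decomp (p : Set ℝ → Prop) : ℕ → Set ℝ → Prop
  | empty (K : ℕ) : Decomp p K ∅
  | piece {K : ℕ} {S : Set ℝ} (hK : 1 ≤ K) (hS : S.OrdConnected) (hp : p S) : Decomp p K S
  | union {K L : ℕ} {S T : Set ℝ} (hS : Decomp p K S) (hT : Decomp p L T)
      (hd : Disjoint S T) : Decomp p (K + L) (S ∪ T)

namespace Decomp

variable {p q : Set ℝ → Prop} {K L : ℕ} {S : Set ℝ}

theorem mono_card (h : Decomp p K S) : ∀ {L : ℕ}, K ≤ L → Decomp p L S := by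
  induction h with
  | empty K => exact fun _ => .empty _
  | piece hK hS hp => exact fun h => .piece (hK.trans h) hS hp
  | @union K L S T _ _ hd ihS ihT =>
    intro M hM
    have := Decomp.union (ihS (le_refl K)) (ihT (show L ≤ M - K by omega)) hd
    rwa [show K + (M - K) = M by omega] at this

/-- Successive subdivisions multiply the counts. The predicate `P` allows a refinement to discard
points as well as cut intervals. -/
theorem bind_sep {c : ℕ} {P : ℝ → Prop} (h : Decomp p K S)
    (H : ∀ T, T ⊆ S → T.OrdConnected → p T → Decomp q c {t ∈ T | P t}) :
    Decomp q (K * c) {t ∈ S | P t} := by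
  induction h with
  | empty K => simpa using Decomp.empty (K * c)
  | piece hK hS hp => exact (H _ Subset.rfl hS hp).mono_card (Nat.le_mul_of_pos_left _ hK)
  | @union K L S T _ _ hd ihS ihT =>
    have : {t ∈ S ∪ T | P t} = {t ∈ S | P t} ∪ {t ∈ T | P t} := by
      ext t; simp only [mem_ofPred_eq, mem_union, or_and_right]
    rw [add_mul, this]
    exact .union (ihS fun T hT => H T (hT.trans subset_union_left))
      (ihT fun T hT => H T (hT.trans subset_union_right))
      (hd.mono (fun _ h => h.1) (fun _ h => h.1))

theorem bind {c : ℕ} (h : Decomp p K S)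
    (H : ∀ T, T ⊆ S → T.OrdConnected → p T → Decomp q c T) : Decomp q (K * c) S := by
  simpa using h.bind_sep (P := fun _ => True) (by simpa using H)

theorem imp (h : Decomp p K S) (H : ∀ T, T ⊆ S → T.OrdConnected → p T → q T) :
    Decomp q K S := by
  simpa using h.bind (c := 1) fun T hT hT' hp => .piece le_rfl hT' (H T hT hT' hp)

/-- Intended for `g` monotone or antitone on the interval `J`, when preimages of intervals are again
intervals and the count does not grow. -/
theorem inter_preimage {J : Set ℝ} {g : ℝ → ℝ} (h : Decomp p K S)
    (H : ∀ T, T.OrdConnected → p T → (J ∩ g ⁻¹' T).OrdConnected ∧ q (J ∩ g ⁻¹' T)) :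
    Decomp q K (J ∩ g ⁻¹' S) := by
  induction h with
  | empty K => simpa using Decomp.empty K
  | piece hK hS hp => exact .piece hK (H _ hS hp).1 (H _ hS hp).2
  | union _ _ hd ihS ihT =>
    rw [preimage_union, inter_union_distrib_left]
    exact .union ihS ihT
      ((hd.preimage g).mono inter_subset_right inter_subset_right)

theorem measurableSet (h : Decomp p K S) : MeasurableSet S := by
  induction h with
  | empty K => exact .empty
  | piece _ hS _ => exact hS.measurableSet
  | union _ _ _ ihS ihT => exact ihS.union ihT

theorem measure_le {α : Type*} [MeasurableSpace α] {μ : Measure α} {φ : α → ℝ} {Y : Set α}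
    {M : ENNReal} (h : Decomp p K S)
    (H : ∀ T, T ⊆ S → T.OrdConnected → p T → μ (Y ∩ φ ⁻¹' T) ≤ M) :
    μ (Y ∩ φ ⁻¹' S) ≤ K * M := by
  induction h with
  | empty K => simp
  | piece hK hS hp =>
    refine (H _ Subset.rfl hS hp).trans (le_mul_of_one_le_left' ?_)
    exact_mod_cast hK
  | union _ _ hd ihS ihT =>
    rw [preimage_union, inter_union_distrib_left, Nat.cast_add, add_mul]
    exact (measure_union_le _ _).trans (add_le_add
      (ihS fun T hT => H T (hT.trans subset_union_left))
      (ihT fun T hT => H T (hT.trans subset_union_right)))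

/-- Here disjointness of the pieces is essential: unlike the measure bound, additivity of the
integral fails for overlapping sets. -/
theorem norm_setIntegral_le {g : ℝ → ℂ} {M : ℝ} (hM : 0 ≤ M) (h : Decomp p K S)
    (hg : IntegrableOn g S)
    (H : ∀ T, T ⊆ S → T.OrdConnected → p T → ‖∫ t in T, g t‖ ≤ M) :
    ‖∫ t in S, g t‖ ≤ K * M := by
  induction h with
  | empty K => simp only [setIntegral_empty, norm_zero]; positivity
  | piece hK hS hp =>
    refine (H _ Subset.rfl hS hp).trans (le_mul_of_one_le_left hM ?_)
    exact_mod_cast hK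
  | union _ hT hd ihS ihT =>
    rw [setIntegral_union hd hT.measurableSet (hg.mono_set subset_union_left)
      (hg.mono_set subset_union_right), Nat.cast_add, add_mul]
    exact (norm_add_le _ _).trans (add_le_add
      (ihS (hg.mono_set subset_union_left) fun T hT => H T (hT.trans subset_union_left))
      (ihT (hg.mono_set subset_union_right) fun T hT => H T (hT.trans subset_union_right)))

theorem of_finset (F : Finset (Set ℝ)) (hF : ∀ J ∈ F, J.OrdConnected)
    (hd : (F : Set (Set ℝ)).PairwiseDisjoint id) :
    Decomp (fun _ => True) F.card (⋃ J ∈ F, J) := by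
  classical
  induction F using Finset.induction_on with
  | empty => simpa using Decomp.empty (p := fun _ => True) 0
  | insert J F hJ ih =>
    rw [Finset.card_insert_of_notMem hJ, Finset.set_biUnion_insert, add_comm]
    refine .union (.piece le_rfl (hF J (by simp)) trivial)
      (ih (fun I hI => hF I (by simp [hI])) (hd.subset (by simp))) ?_
    rw [disjoint_iUnion₂_right]
    intro I hI
    exact hd (by simp) (by simp [hI]) (fun h => hJ (h ▸ hI))

end Decomp

/-- The given intervals may overlap, so they are replaced by the order-connected components of their
union. Each nonempty interval lies in a single component, so there are no more components than
intervals. -/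
theorem IsUnionOfIntervals.decomp {A : ℕ} {S : Set ℝ} (h : IsUnionOfIntervals A S) :
    Decomp (fun _ => True) A S := by
  classical
  obtain ⟨I, hI, rfl⟩ := h
  set S := ⋃ k, I k with hS
  let F : Finset (Set ℝ) := (Finset.univ.filter fun k => (I k).Nonempty).image
    fun k => if h : (I k).Nonempty then ordConnectedComponent S h.choose else ∅
  have hF : ∀ J ∈ F, ∃ x ∈ S, J = ordConnectedComponent S x := by
    intro J hJ
    simp only [F, Finset.mem_image, Finset.mem_filter, Finset.mem_univ, true_and] at hJ
    obtain ⟨k, hk, rfl⟩ := hJ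
    rw [dif_pos hk]
    exact ⟨_, mem_iUnion.2 ⟨k, hk.choose_spec⟩, rfl⟩
  have hcard : F.card ≤ A := by
    refine Finset.card_image_le.trans ((Finset.card_filter_le _ _).trans ?_)
    simp
  have hun : S = ⋃ J ∈ F, J := by
    apply Subset.antisymm
    · intro x hx
      obtain ⟨k, hk⟩ := mem_iUnion.1 (hS ▸ hx)
      have hne : (I k).Nonempty := ⟨x, hk⟩
      refine mem_iUnion₂.2 ⟨_, Finset.mem_image.2 ⟨k, by simp [hne], rfl⟩, ?_⟩
      rw [dif_pos hne]
      have := hI k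
      exact subset_ordConnectedComponent hne.choose_spec (subset_iUnion I k) hk
    · refine iUnion₂_subset fun J hJ => ?_
      obtain ⟨x, -, rfl⟩ := hF J hJ
      exact ordConnectedComponent_subset
  rw [hun]
  refine (Decomp.of_finset F ?_ ?_).mono_card hcard
  · intro J hJ
    obtain ⟨x, -, rfl⟩ := hF J hJ
    infer_instance
  · intro J hJ J' hJ' hne
    obtain ⟨x, hx, rfl⟩ := hF J hJ
    obtain ⟨y, hy, rfl⟩ := hF J' hJ'
    simp only [Function.onFun, id]
    by_contra hnd
    obtain ⟨z, hz, hz'⟩ := not_disjoint_iff.1 hnd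
    exact hne ((ordConnectedComponent_eq hz).trans (ordConnectedComponent_eq hz').symm)

/-! ### Sign and monotonicity decompositions for chains of derivatives -/

/-- `h (i + 1)` is the derivative of `h i` on `S`, for all `i`. -/
def DerivChainOn (h : ℕ → ℝ → ℝ) (S : Set ℝ) : Prop :=
  ∀ t ∈ S, ∀ i, HasDerivAt (h i) (h (i + 1) t) t

theorem DerivChainOn.mono {h : ℕ → ℝ → ℝ} {S T : Set ℝ} (hh : DerivChainOn h S) (hT : T ⊆ S) :
    DerivChainOn h T := fun t ht => hh t (hT ht)

theorem DerivChainOn.continuousOn {h : ℕ → ℝ → ℝ} {S : Set ℝ} (hh : DerivChainOn h S) (i : ℕ) :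
    ContinuousOn (h i) S := fun t ht => (hh t ht i).continuousAt.continuousWithinAt

theorem SingleSignedOn.mono {E : Type*} {g : E → ℝ} {S T : Set E} (h : SingleSignedOn g S)
    (hT : T ⊆ S) : SingleSignedOn g T :=
  h.imp (fun h x hx => h x (hT hx)) (fun h x hx => h x (hT hx))

/-- A function with single-signed derivative on an interval is monotone or antitone there. -/
theorem monotoneOn_or_antitoneOn {g g' : ℝ → ℝ} {J : Set ℝ} (hJ : J.OrdConnected)
    (hg : ∀ t ∈ J, HasDerivAt g (g' t) t) (hs : SingleSignedOn g' J) :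
    MonotoneOn g J ∨ AntitoneOn g J := by
  have hc : ContinuousOn g J := fun t ht => (hg t ht).continuousAt.continuousWithinAt
  refine hs.imp (fun h => ?_) (fun h => ?_)
  · exact monotoneOn_of_hasDerivWithinAt_nonneg hJ.convex hc
      (fun t ht => (hg t (interior_subset ht)).hasDerivWithinAt)
      (fun t ht => h t (interior_subset ht))
  · exact antitoneOn_of_hasDerivWithinAt_nonpos hJ.convex hc
      (fun t ht => (hg t (interior_subset ht)).hasDerivWithinAt)
      (fun t ht => h t (interior_subset ht))

theorem ordConnected_inter_preimage {g : ℝ → ℝ} {J T : Set ℝ} (hJ : J.OrdConnected)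
    (hT : T.OrdConnected) (hg : MonotoneOn g J ∨ AntitoneOn g J) :
    (J ∩ g ⁻¹' T).OrdConnected := by
  refine ⟨fun x hx y hy z hz => ?_⟩
  have hzJ : z ∈ J := hJ.out hx.1 hy.1 hz
  refine ⟨hzJ, ?_⟩
  rcases hg with hg | hg
  · exact hT.out hx.2 hy.2 ⟨hg hx.1 hzJ hz.1, hg hzJ hy.1 hz.2⟩
  · exact hT.out hy.2 hx.2 ⟨hg hzJ hy.1 hz.2, hg hx.1 hzJ hz.1⟩

/-- Induction down the chain: once `h 1` has one sign on a piece, `h 0` is monotone there and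
changes sign at most once, so each step doubles the number of pieces. -/
theorem decomp_singleSigned : ∀ (k : ℕ) {h : ℕ → ℝ → ℝ} {I : Set ℝ}, I.OrdConnected →
    DerivChainOn h I → SingleSignedOn (h k) I →
    Decomp (fun J => ∀ i ≤ k, SingleSignedOn (h i) J) (2 ^ k) I := by
  intro k
  induction k with
  | zero =>
    intro h I hI hh hs
    exact .piece le_rfl hI fun i hi => by rwa [Nat.le_zero.1 hi]
  | succ k ih =>
    intro h I hI hh hs
    have := ih (h := fun i => h (i + 1)) hI (fun t ht i => hh t ht (i + 1)) hs
    rw [pow_succ]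
    refine this.bind fun J hJI hJ hJs => ?_
    have hm := monotoneOn_or_antitoneOn hJ (fun t ht => hh t (hJI ht) 0) (hJs 0 (Nat.zero_le _))
    have hun : J = (J ∩ h 0 ⁻¹' Ici 0) ∪ (J ∩ h 0 ⁻¹' Iio 0) := by
      rw [← inter_union_distrib_left, ← preimage_union, Ici_union_Iio, preimage_univ, inter_univ]
    rw [hun]
    refine Decomp.union (K := 1) (L := 1)
      (.piece le_rfl (ordConnected_inter_preimage hJ ordConnected_Ici hm) ?_)
      (.piece le_rfl (ordConnected_inter_preimage hJ ordConnected_Iio hm) ?_) ?_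
    · intro i hi
      rcases i with _ | i
      · exact .inl fun x hx => hx.2
      · exact (hJs i (by omega)).mono inter_subset_left
    · intro i hi
      rcases i with _ | i
      · exact .inr fun x hx => (mem_Iio.1 hx.2).le
      · exact (hJs i (by omega)).mono inter_subset_left
    · rw [disjoint_left]
      rintro x ⟨-, hx⟩ ⟨-, hx'⟩
      exact absurd (mem_Ici.1 hx) (not_le.2 (show h 0 x < 0 from hx'))

/-- The part of an interval where `|g| ≥ δ`, for `g` monotone, is a disjoint union of two
intervals. -/
theorem decomp_le_abs {g : ℝ → ℝ} {J : Set ℝ} {δ : ℝ} (hδ : 0 < δ) (hJ : J.OrdConnected)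
    (hg : MonotoneOn g J ∨ AntitoneOn g J) :
    Decomp (fun _ => True) 2 {t ∈ J | δ ≤ |g t|} := by
  have hun : {t ∈ J | δ ≤ |g t|} = (J ∩ g ⁻¹' Ici δ) ∪ (J ∩ g ⁻¹' Iic (-δ)) := by
    ext t
    simp only [mem_ofPred_eq, mem_union, mem_inter_iff, mem_preimage, mem_Ici, mem_Iic, le_abs,
      ← and_or_left, le_neg]
  rw [hun]
  refine Decomp.union (K := 1) (L := 1)
    (.piece le_rfl (ordConnected_inter_preimage hJ ordConnected_Ici hg) trivial)
    (.piece le_rfl (ordConnected_inter_preimage hJ ordConnected_Iic hg) trivial) ?_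
  rw [disjoint_left]
  rintro x ⟨-, hx⟩ ⟨-, hx'⟩
  simp only [mem_preimage, mem_Ici, mem_Iic] at hx hx'
  linarith

theorem ordConnected_abs_lt {g : ℝ → ℝ} {J : Set ℝ} {δ : ℝ} (hJ : J.OrdConnected)
    (hg : MonotoneOn g J ∨ AntitoneOn g J) : {t ∈ J | |g t| < δ}.OrdConnected := by
  have : {t ∈ J | |g t| < δ} = J ∩ g ⁻¹' Ioo (-δ) δ := by
    ext t; simp only [mem_ofPred_eq, abs_lt, mem_inter_iff, mem_preimage, mem_Ioo]
  rw [this]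
  exact ordConnected_inter_preimage hJ ordConnected_Ioo hg

/-! ### Sublevel estimates in one variable -/

/-- If `|h 0| ≤ δ` on an interval of length `L`, then `|h b|` is `O(δ / L ^ b)` somewhere. -/
theorem exists_abs_deriv_le : ∀ b : ℕ, ∃ C : ℝ, 0 < C ∧ ∀ (h : ℕ → ℝ → ℝ) (a L δ : ℝ), 0 < L →
    DerivChainOn h (Icc a (a + L)) → (∀ t ∈ Icc a (a + L), |h 0 t| ≤ δ) →
    ∃ ξ ∈ Icc a (a + L), |h b ξ| * L ^ b ≤ C * δ := by
  intro b
  induction b with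
  | zero =>
    refine ⟨1, one_pos, fun h a L δ hL _ hδ => ⟨a, ⟨le_rfl, by linarith⟩, ?_⟩⟩
    simpa using hδ a ⟨le_rfl, by linarith⟩
  | succ b ih =>
    obtain ⟨C, hC, H⟩ := ih
    refine ⟨2 * C * 3 ^ (b + 1), by positivity, fun h a L δ hL hh hδ => ?_⟩
    -- The inductive bound is used on the two outer thirds. The points found there are at least `L /
    -- 3` apart, so the mean value theorem between them bounds the next derivative.
    have s1 : Icc a (a + L / 3) ⊆ Icc a (a + L) := Icc_subset_Icc le_rfl (by linarith)
    have s2 : Icc (a + 2 * L / 3) (a + 2 * L / 3 + L / 3) ⊆ Icc a (a + L) :=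
      Icc_subset_Icc (by linarith) (by linarith)
    obtain ⟨x, hx, hxb⟩ := H h a (L / 3) δ (by positivity) (hh.mono s1) fun t ht => hδ t (s1 ht)
    obtain ⟨y, hy, hyb⟩ := H h (a + 2 * L / 3) (L / 3) δ (by positivity) (hh.mono s2)
      fun t ht => hδ t (s2 ht)
    have hxy : L / 3 ≤ y - x := by linarith [hx.2, hy.1]
    have hlt : x < y := by linarith
    have hsub : Icc x y ⊆ Icc a (a + L) := Icc_subset_Icc (s1 hx).1 (s2 hy).2
    obtain ⟨ξ, hξ, he⟩ := exists_hasDerivAt_eq_slope (h b) (h (b + 1)) hlt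
      ((hh.mono hsub).continuousOn b) fun t ht => hh t (hsub (Ioo_subset_Icc_self ht)) b
    refine ⟨ξ, hsub (Ioo_subset_Icc_self hξ), ?_⟩
    have h1 : |h (b + 1) ξ| * (y - x) ≤ |h b y| + |h b x| := by
      have h2 : h (b + 1) ξ * (y - x) = h b y - h b x := by
        rw [he, div_mul_cancel₀ _ (by linarith)]
      rw [← abs_of_pos (show 0 < y - x by linarith), ← abs_mul, h2]
      exact abs_sub _ _
    have h3 : |h (b + 1) ξ| * (L / 3) ≤ |h b y| + |h b x| :=
      (mul_le_mul_of_nonneg_left hxy (abs_nonneg _)).trans h1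
    have h4 := mul_le_mul_of_nonneg_right h3 (show 0 ≤ (L / 3) ^ b by positivity)
    have h5 : |h (b + 1) ξ| * L ^ (b + 1)
        = 3 ^ (b + 1) * (|h (b + 1) ξ| * (L / 3) * (L / 3) ^ b) := by
      rw [div_pow]; field_simp; ring
    rw [h5]
    calc _ ≤ 3 ^ (b + 1) * (C * δ + C * δ) := by
          refine mul_le_mul_of_nonneg_left (h4.trans ?_) (by positivity)
          rw [add_mul]; exact add_le_add hyb hxb
      _ = _ := by ring

/-- An interval of length `L` on which `|h b| ≥ δ'` and `|h 0| < δ` satisfies `L^b ≤ C δ / δ'`, by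
`exists_abs_deriv_le`. It remains to count intervals: at most `A` components, `2^N` sign pieces in
each, and two parts where `|h b| ≥ δ'`. -/
theorem slice_sublevel (A b N : ℕ) (hb : 1 ≤ b) (hbN : b ≤ N) : ∃ C : ℝ, 0 ≤ C ∧
    ∀ (S : Set ℝ) (h : ℕ → ℝ → ℝ), IsUnionOfIntervals A S → DerivChainOn h S →
      (∀ J ⊆ S, J.OrdConnected → SingleSignedOn (h N) J) → ∀ δ δ' : ℝ, 0 < δ → 0 < δ' →
      (b < N ∨ ∀ t ∈ S, δ' ≤ |h b t|) →
      volume {t ∈ S | δ' ≤ |h b t| ∧ |h 0 t| < δ} ≤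
        ENNReal.ofReal (C * (δ / δ') ^ (1 / (b : ℝ))) := by
  obtain ⟨C, hC, H⟩ := exists_abs_deriv_le b
  refine ⟨(A * (2 ^ N * (2 * 1)) : ℕ) * C ^ (1 / (b : ℝ)), by positivity, ?_⟩
  intro S h hS hh hs δ δ' hδ hδ' hbd
  have hb0 : (b : ℝ) ≠ 0 := by positivity
  have hlen : ∀ T ⊆ S, T.OrdConnected → (∀ t ∈ T, δ' ≤ |h b t| ∧ |h 0 t| < δ) →
      volume T ≤ ENNReal.ofReal ((C * (δ / δ')) ^ (1 / (b : ℝ))) := by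
    intro T hTS hT hTp
    refine (Real.volume_le_diam T).trans (Metric.ediam_le_of_forall_dist_le fun x hx y hy => ?_)
    wlog hxy : x < y generalizing x y
    · rcases eq_or_lt_of_le (not_lt.1 hxy) with h | h
      · rw [h, dist_self]; positivity
      · rw [dist_comm]; exact this y hy x hx h
    rw [dist_comm, Real.dist_eq, abs_of_pos (sub_pos.2 hxy)]
    have hsub : Icc x (x + (y - x)) ⊆ T := by
      rw [add_sub_cancel]; exact hT.out hx hy
    obtain ⟨ξ, hξ, hle⟩ := H h x (y - x) δ (sub_pos.2 hxy) (hh.mono (hsub.trans hTS))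
      fun t ht => (hTp t (hsub ht)).2.le
    have h1 : (y - x) ^ b ≤ C * (δ / δ') := by
      rw [← mul_div_assoc, le_div_iff₀ hδ', mul_comm]
      exact (mul_le_mul_of_nonneg_right (hTp ξ (hsub hξ)).1
        (pow_nonneg (sub_pos.2 hxy).le _)).trans hle
    calc y - x = ((y - x) ^ b) ^ (1 / (b : ℝ)) := by
          rw [one_div, Real.pow_rpow_inv_natCast (sub_pos.2 hxy).le (by omega)]
      _ ≤ _ := Real.rpow_le_rpow (pow_nonneg (sub_pos.2 hxy).le _) h1 (by positivity)
  have hd : Decomp (fun T => ∀ t ∈ T, δ' ≤ |h b t| ∧ |h 0 t| < δ) (A * (2 ^ N * (2 * 1)))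
      {t ∈ S | δ' ≤ |h b t| ∧ |h 0 t| < δ} := by
    refine hS.decomp.bind_sep fun I hIS hI _ => ?_
    refine (decomp_singleSigned N hI (hh.mono hIS) (hs I hIS hI)).bind_sep fun J hJI hJ hJs => ?_
    have hJS := hJI.trans hIS
    have hmono : ∀ i < N, MonotoneOn (h i) J ∨ AntitoneOn (h i) J := fun i hi =>
      monotoneOn_or_antitoneOn hJ (fun t ht => hh t (hJS ht) i) (hJs (i + 1) hi)
    have h1 : Decomp (fun _ => True) 2 {t ∈ J | δ' ≤ |h b t|} := by
      -- For `b < N` the sign of `h (b + 1)` makes `h b` monotone; in the other case the lower bound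
      -- holds on the whole slice and nothing has to be cut.
      rcases hbd with hlt | hall
      · exact decomp_le_abs hδ' hJ (hmono b hlt)
      · rw [show {t ∈ J | δ' ≤ |h b t|} = J from
          Subset.antisymm (fun t ht => ht.1) fun t ht => ⟨ht, hall t (hJS ht)⟩]
        exact .piece one_le_two hJ trivial
    have h2 := h1.bind_sep (c := 1) (P := fun t => |h 0 t| < δ)
      (q := fun T => ∀ t ∈ T, δ' ≤ |h b t| ∧ |h 0 t| < δ) fun T hT hTo _ => by
        refine .piece le_rfl (ordConnected_abs_lt hTo ?_) fun t ht => ⟨(hT ht.1).2, ht.2⟩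
        exact (hmono 0 (by omega)).imp (fun h => h.mono fun t ht => (hT ht).1)
          (fun h => h.mono fun t ht => (hT ht).1)
    convert h2 using 1
    ext t; simp only [mem_ofPred_eq, and_assoc]
  have h3 := hd.measure_le (μ := volume) (Y := univ) (φ := id)
    (M := ENNReal.ofReal ((C * (δ / δ')) ^ (1 / (b : ℝ)))) fun T hT hTo hTp => by
      simpa using hlen T (hT.trans fun t ht => ht.1) hTo hTp
  rw [univ_inter, preimage_id] at h3
  refine h3.trans (le_of_eq ?_)
  rw [mul_assoc, ENNReal.ofReal_mul (by positivity), ENNReal.ofReal_natCast,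
    Real.mul_rpow hC.le (by positivity)]

/-! ### Oscillatory integrals in one variable -/

/-- A set integral over a bounded interval is controlled by the integrals over its compact
subintervals. -/
theorem norm_setIntegral_le_of_Icc {g : ℝ → ℂ} {J : Set ℝ} {M : ℝ} (hM : 0 ≤ M)
    (hJ : J.OrdConnected) (hb : Bornology.IsBounded J) (hg : IntegrableOn g J)
    (H : ∀ a b, a ≤ b → Icc a b ⊆ J → ‖∫ t in a..b, g t‖ ≤ M) : ‖∫ t in J, g t‖ ≤ M := by
  rcases J.eq_empty_or_nonempty with rfl | hne
  · simpa using hM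
  have hlo := hb.bddBelow
  have hup := hb.bddAbove
  set a := sInf J with ha
  set b := sSup J with hb'
  have hsub : J ⊆ Icc a b := fun x hx => ⟨csInf_le hlo hx, le_csSup hup hx⟩
  have hsup : Ioo a b ⊆ J := by
    rintro x ⟨hx1, hx2⟩
    obtain ⟨y, hy, hyx⟩ := exists_lt_of_csInf_lt hne hx1
    obtain ⟨z, hz, hxz⟩ := exists_lt_of_lt_csSup hne hx2
    exact hJ.out hy hz ⟨hyx.le, hxz.le⟩
  have hab : a ≤ b := (hsub hne.some_mem).1.trans (hsub hne.some_mem).2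
  have hae : J =ᵐ[volume] Ioo a b :=
    ((LE.le.eventuallyLE hsub).trans_eq Ioo_ae_eq_Icc.symm).antisymm (LE.le.eventuallyLE hsup)
  rw [setIntegral_congr_set hae]
  rcases hab.eq_or_lt with h | h
  · simpa [h] using hM
  -- The interval is exhausted by compact ones, each end trimmed by at most a third of the length so
  -- that the endpoints stay ordered.
  have hlim : Filter.Tendsto (fun n : ℕ => (b - a) / 3 * (1 / ((n : ℝ) + 1))) Filter.atTop
      (nhds 0) := by
    simpa using tendsto_one_div_add_atTop_nhds_zero_nat.const_mul ((b - a) / 3)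
  have h1 : Filter.Tendsto (fun n : ℕ => a + (b - a) / 3 * (1 / ((n : ℝ) + 1))) Filter.atTop
      (nhds a) := by simpa using hlim.const_add a
  have h2 : Filter.Tendsto (fun n : ℕ => b - (b - a) / 3 * (1 / ((n : ℝ) + 1))) Filter.atTop
      (nhds b) := by simpa using hlim.const_sub b
  have hcov := aecover_Ioo_of_Icc (μ := volume) h1 h2
  have hlimI := hcov.integral_tendsto_of_countably_generated (hg.mono_set hsup)
  refine le_of_tendsto hlimI.norm (Filter.Eventually.of_forall fun n => ?_)
  have hn : 0 < 1 / ((n : ℝ) + 1) := by positivity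
  have hn1 : 1 / ((n : ℝ) + 1) ≤ 1 := by
    rw [div_le_one (by positivity)]; linarith [n.cast_nonneg (α := ℝ)]
  have h3 : 0 < (b - a) / 3 * (1 / ((n : ℝ) + 1)) := mul_pos (by linarith) hn
  have h4 : (b - a) / 3 * (1 / ((n : ℝ) + 1)) ≤ (b - a) / 3 :=
    mul_le_of_le_one_right (by linarith) hn1
  set e := (b - a) / 3 * (1 / ((n : ℝ) + 1))
  have h5 : Icc (a + e) (b - e) ⊆ Ioo a b := fun x hx => ⟨by linarith [hx.1], by linarith [hx.2]⟩
  rw [Measure.restrict_restrict measurableSet_Icc, inter_eq_self_of_subset_left h5,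
    integral_Icc_eq_integral_Ioc, ← intervalIntegral.integral_of_le (by linarith)]
  exact H _ _ (by linarith) (h5.trans hsup)

/-- The total variation of a monotone function is the difference of its end values. -/
theorem integral_abs_deriv_le {u u' : ℝ → ℝ} {a b B : ℝ} (hab : a ≤ b)
    (hu : ∀ t ∈ Icc a b, HasDerivAt u (u' t) t) (hc : ContinuousOn u' (Icc a b))
    (hs : SingleSignedOn u' (Icc a b)) (hB : ∀ t ∈ Icc a b, |u t| ≤ B) :
    ∫ t in a..b, |u' t| ≤ 2 * B := by
  have hInt : IntervalIntegrable u' volume a b :=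
    (hc.mono (by rw [uIcc_of_le hab])).intervalIntegrable
  have hftc : ∫ t in a..b, u' t = u b - u a :=
    intervalIntegral.integral_eq_sub_of_hasDerivAt (by rwa [uIcc_of_le hab]) hInt
  have ha := abs_le.1 (hB a (left_mem_Icc.2 hab))
  have hb := abs_le.1 (hB b (right_mem_Icc.2 hab))
  rcases hs with hs | hs
  · rw [intervalIntegral.integral_congr (g := u') fun t ht =>
      abs_of_nonneg (hs t (by rwa [uIcc_of_le hab] at ht)), hftc]
    linarith
  · rw [intervalIntegral.integral_congr (g := fun t => -u' t) fun t ht =>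
      abs_of_nonpos (hs t (by rwa [uIcc_of_le hab] at ht)), intervalIntegral.integral_neg, hftc]
    linarith

/-- The first-derivative van der Corput estimate for the phase `lam * P (h 0)`. -/
theorem norm_integral_exp_le {h : ℕ → ℝ → ℝ} {a b s η lam : ℝ} {P : Polynomial ℝ} (hab : a ≤ b)
    (hh : DerivChainOn h (Icc a b)) (hs : 0 < s) (hη : 0 < η) (hlam : lam ≠ 0)
    (h1 : ∀ t ∈ Icc a b, η ≤ |h 1 t|)
    (hQ : ∀ t ∈ Icc a b, s ≤ |P.derivative.eval (h 0 t)|)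
    (h1s : SingleSignedOn (h 1) (Icc a b)) (h2s : SingleSignedOn (h 2) (Icc a b))
    (hQs : SingleSignedOn (fun t => P.derivative.derivative.eval (h 0 t)) (Icc a b)) :
    ‖∫ t in a..b, Complex.exp (Complex.I * ((lam * P.eval (h 0 t) : ℝ) : ℂ))‖ ≤
      6 / (|lam| * s * η) := by
  set Q := P.derivative with hQdef
  -- The amplitude `u v` is the reciprocal of the phase derivative up to the factor `lam`. Each
  -- factor is monotone, since the signs of `Q'(h 0) * h 1` and of `h 2` are fixed. Integration by
  -- parts gives `2 / (s η)` from the endpoints and `4 / (s η)` from the variation of `u v`, hence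
  -- the constant 6.
  set u : ℝ → ℝ := fun t => (Q.eval (h 0 t))⁻¹
  set v : ℝ → ℝ := fun t => (h 1 t)⁻¹
  set u' : ℝ → ℝ := fun t => -(Q.derivative.eval (h 0 t) * h 1 t) / Q.eval (h 0 t) ^ 2
  set v' : ℝ → ℝ := fun t => -h 2 t / h 1 t ^ 2
  set E : ℝ → ℂ := fun t => Complex.exp (Complex.I * ((lam * P.eval (h 0 t) : ℝ) : ℂ)) with hE
  have hQ0 : ∀ t ∈ Icc a b, Q.eval (h 0 t) ≠ 0 := fun t ht =>
    abs_pos.1 (hs.trans_le (hQ t ht))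
  have h10 : ∀ t ∈ Icc a b, h 1 t ≠ 0 := fun t ht => abs_pos.1 (hη.trans_le (h1 t ht))
  have hu : ∀ t ∈ Icc a b, HasDerivAt u (u' t) t := fun t ht =>
    ((Q.hasDerivAt (h 0 t)).comp t (hh t ht 0)).inv (hQ0 t ht)
  have hv : ∀ t ∈ Icc a b, HasDerivAt v (v' t) t := fun t ht => (hh t ht 1).inv (h10 t ht)
  have huB : ∀ t ∈ Icc a b, |u t| ≤ 1 / s := fun t ht => by
    simp only [u]
    rw [abs_inv, ← one_div]
    exact one_div_le_one_div_of_le hs (hQ t ht)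
  have hvB : ∀ t ∈ Icc a b, |v t| ≤ 1 / η := fun t ht => by
    simp only [v]
    rw [abs_inv, ← one_div]
    exact one_div_le_one_div_of_le hη (h1 t ht)
  have hc := hh.continuousOn
  have hcp : ∀ R : Polynomial ℝ, ContinuousOn (fun t => R.eval (h 0 t)) (Icc a b) := fun R =>
    R.continuous.comp_continuousOn (hc 0)
  have huc : ContinuousOn u' (Icc a b) :=
    (((hcp _).mul (hc 1)).neg).div ((hcp Q).pow 2) fun t ht => pow_ne_zero _ (hQ0 t ht)
  have hvc : ContinuousOn v' (Icc a b) :=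
    (hc 2).neg.div ((hc 1).pow 2) fun t ht => pow_ne_zero _ (h10 t ht)
  have hvs : SingleSignedOn v' (Icc a b) := by
    refine h2s.symm.imp (fun H t ht => ?_) (fun H t ht => ?_)
    · exact div_nonneg (neg_nonneg.2 (H t ht)) (sq_nonneg _)
    · exact div_nonpos_of_nonpos_of_nonneg (neg_nonpos.2 (H t ht)) (sq_nonneg _)
  have hus : SingleSignedOn u' (Icc a b) := by
    have : SingleSignedOn (fun t => Q.derivative.eval (h 0 t) * h 1 t) (Icc a b) := by
      rcases hQs with H | H <;> rcases h1s with H' | H'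
      · exact .inl fun t ht => mul_nonneg (H t ht) (H' t ht)
      · exact .inr fun t ht => mul_nonpos_of_nonneg_of_nonpos (H t ht) (H' t ht)
      · exact .inr fun t ht => mul_nonpos_of_nonpos_of_nonneg (H t ht) (H' t ht)
      · exact .inl fun t ht => mul_nonneg_of_nonpos_of_nonpos (H t ht) (H' t ht)
    refine this.symm.imp (fun H t ht => ?_) (fun H t ht => ?_)
    · exact div_nonneg (neg_nonneg.2 (H t ht)) (sq_nonneg _)
    · exact div_nonpos_of_nonpos_of_nonneg (neg_nonpos.2 (H t ht)) (sq_nonneg _)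
  have hIu := integral_abs_deriv_le hab hu huc hus huB
  have hIv := integral_abs_deriv_le hab hv hvc hvs hvB
  have hE1 : ∀ t, ‖E t‖ = 1 := fun t => by
    simp only [hE]; rw [mul_comm]; exact Complex.norm_exp_ofReal_mul_I _
  set E' : ℝ → ℂ := fun t => E t * (Complex.I * ((lam * (Q.eval (h 0 t) * h 1 t) : ℝ) : ℂ))
  have hEd : ∀ t ∈ Icc a b, HasDerivAt E (E' t) t := fun t ht =>
    ((((P.hasDerivAt (h 0 t)).comp t (hh t ht 0)).const_mul lam).ofReal_comp.const_mul
      Complex.I).cexp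
  set W : ℝ → ℂ := fun t => ((u t * v t : ℝ) : ℂ)
  set W' : ℝ → ℂ := fun t => ((u' t * v t + u t * v' t : ℝ) : ℂ)
  have hW : ∀ t ∈ Icc a b, HasDerivAt W (W' t) t := fun t ht =>
    ((hu t ht).mul (hv t ht)).ofReal_comp
  have hui : uIcc a b = Icc a b := uIcc_of_le hab
  have hEc : ContinuousOn E (Icc a b) := fun t ht => (hEd t ht).continuousAt.continuousWithinAt
  have huc0 : ContinuousOn u (Icc a b) := fun t ht => (hu t ht).continuousAt.continuousWithinAt
  have hvc0 : ContinuousOn v (Icc a b) := fun t ht => (hv t ht).continuousAt.continuousWithinAt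
  have hWc : ContinuousOn W' (Icc a b) :=
    Complex.continuous_ofReal.comp_continuousOn ((huc.mul hvc0).add (huc0.mul hvc))
  have hE'c : ContinuousOn E' (Icc a b) :=
    hEc.mul (continuousOn_const.mul (Complex.continuous_ofReal.comp_continuousOn
      (continuousOn_const.mul ((hcp Q).mul (hc 1)))))
  have hparts := intervalIntegral.integral_mul_deriv_eq_deriv_mul
    (u := W) (v := E) (u' := W') (v' := E') (a := a) (b := b)
    (fun t ht => hW t (hui ▸ ht)) (fun t ht => hEd t (hui ▸ ht))
    (hWc.mono hui.le).intervalIntegrable (hE'c.mono hui.le).intervalIntegrable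
  have hlhs : ∫ t in a..b, W t * E' t = (Complex.I * (lam : ℂ)) * ∫ t in a..b, E t := by
    rw [← intervalIntegral.integral_const_mul]
    refine intervalIntegral.integral_congr fun t ht => ?_
    have hq := hQ0 t (hui ▸ ht)
    have hp := h10 t (hui ▸ ht)
    simp only [W, E', u, v]
    push_cast
    have hq' : (((Q.eval (h 0 t) : ℝ)) : ℂ) ≠ 0 := by exact_mod_cast hq
    have hp' : ((h 1 t : ℝ) : ℂ) ≠ 0 := by exact_mod_cast hp
    field_simp
  have hWB : ∀ t ∈ Icc a b, ‖W t‖ ≤ 1 / s * (1 / η) := fun t ht => by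
    simp only [W, Complex.norm_real, Real.norm_eq_abs, abs_mul]
    exact mul_le_mul (huB t ht) (hvB t ht) (abs_nonneg _) (by positivity)
  have hInt : ‖∫ t in a..b, W' t * E t‖ ≤ 2 * (1 / s) * (1 / η) + (1 / s) * (2 * (1 / η)) := by
    have hau : IntervalIntegrable (fun t => |u' t| * (1 / η)) volume a b :=
      ((huc.abs.mul continuousOn_const).mono hui.le).intervalIntegrable
    have hav : IntervalIntegrable (fun t => (1 / s) * |v' t|) volume a b :=
      ((continuousOn_const.mul hvc.abs).mono hui.le).intervalIntegrable
    calc _ ≤ ∫ t in a..b, (|u' t| * (1 / η) + (1 / s) * |v' t|) := by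
          refine intervalIntegral.norm_integral_le_of_norm_le hab ?_ (hau.add hav)
          refine Filter.Eventually.of_forall fun t ht => ?_
          have ht' := Ioc_subset_Icc_self ht
          rw [norm_mul, hE1, mul_one]
          simp only [W', Complex.norm_real, Real.norm_eq_abs]
          refine (abs_add_le _ _).trans ?_
          rw [abs_mul, abs_mul]
          exact add_le_add (mul_le_mul_of_nonneg_left (hvB t ht') (abs_nonneg _))
            (mul_le_mul_of_nonneg_right (huB t ht') (abs_nonneg _))
      _ = (∫ t in a..b, |u' t|) * (1 / η) + (1 / s) * ∫ t in a..b, |v' t| := by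
          rw [intervalIntegral.integral_add hau hav, intervalIntegral.integral_mul_const,
            intervalIntegral.integral_const_mul]
      _ ≤ _ := by gcongr
  have hfin : |lam| * ‖∫ t in a..b, E t‖ ≤ 6 * (1 / s * (1 / η)) := by
    have hn : ‖(Complex.I * (lam : ℂ)) * ∫ t in a..b, E t‖ = |lam| * ‖∫ t in a..b, E t‖ := by
      simp
    rw [← hn, ← hlhs, hparts]
    refine (norm_sub_le _ _).trans ((add_le_add (norm_sub_le _ _) hInt).trans ?_)
    rw [norm_mul, norm_mul, hE1, hE1, mul_one, mul_one]
    have := hWB a (left_mem_Icc.2 hab)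
    have := hWB b (right_mem_Icc.2 hab)
    linarith
  rw [le_div_iff₀ (by positivity)]
  calc _ = (|lam| * ‖∫ t in a..b, E t‖) * (s * η) := by ring
    _ ≤ 6 * (1 / s * (1 / η)) * (s * η) := by gcongr
    _ = 6 := by field_simp

theorem derivChainOn_polynomial (Q : Polynomial ℝ) (S : Set ℝ) :
    DerivChainOn (fun i t => (Polynomial.derivative^[i] Q).eval t) S := fun t _ i => by
  simp only [Function.iterate_succ_apply']
  exact Polynomial.hasDerivAt _ t

theorem singleSignedOn_iterate_derivative {Q : Polynomial ℝ} {m : ℕ} (hQ : Q.natDegree ≤ m)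
    (S : Set ℝ) : SingleSignedOn (fun t => (Polynomial.derivative^[m] Q).eval t) S := by
  have h0 : (Polynomial.derivative^[m] Q).natDegree = 0 := by
    have := Polynomial.natDegree_iterate_derivative Q m
    omega
  rw [Polynomial.eq_C_of_natDegree_eq_zero h0]
  simp only [Polynomial.eval_C]
  exact (le_total 0 _).imp (fun h _ _ => h) (fun h _ _ => h)

theorem decomp_polynomial {Q : Polynomial ℝ} {m : ℕ} (hQ : Q.natDegree ≤ m) :
    Decomp (fun J => SingleSignedOn (fun t => Q.derivative.eval t) J) (2 ^ (m + 1)) univ := by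
  -- The order `m + 1`, not `m`, ensures that the sign of the first derivative is among those
  -- controlled even when `m = 0`.
  refine (decomp_singleSigned (m + 1) ordConnected_univ (derivChainOn_polynomial Q univ)
    (singleSignedOn_iterate_derivative (by omega) univ)).imp fun T _ _ hT => ?_
  exact hT 1 (by omega)

theorem decomp_polynomial_le_abs {Q : Polynomial ℝ} {m : ℕ} (hQ : Q.natDegree ≤ m) {s : ℝ}
    (hs : 0 < s) :
    Decomp (fun J => (∀ t ∈ J, s ≤ |Q.eval t|) ∧
      SingleSignedOn (fun t => Q.derivative.eval t) J) (2 ^ (m + 1) * 2) {t | s ≤ |Q.eval t|} := by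
  have := (decomp_polynomial hQ).bind_sep (c := 2) (P := fun t => s ≤ |Q.eval t|)
    (q := fun J => (∀ t ∈ J, s ≤ |Q.eval t|) ∧
      SingleSignedOn (fun t => Q.derivative.eval t) J) fun T _ hT hTs =>
    (decomp_le_abs hs hT (monotoneOn_or_antitoneOn hT (fun t _ => Q.hasDerivAt t) hTs)).imp
      fun J hJ _ _ => ⟨fun t ht => (hJ ht).2, hTs.mono fun t ht => (hJ ht).1⟩
  simpa using this

theorem decomp_polynomial_abs_lt {Q : Polynomial ℝ} {m : ℕ} (hQ : Q.natDegree ≤ m) (s : ℝ) :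
    Decomp (fun J => ∀ t ∈ J, |Q.eval t| < s) (2 ^ (m + 1)) {t | |Q.eval t| < s} := by
  have := (decomp_polynomial hQ).bind_sep (c := 1) (P := fun t => |Q.eval t| < s)
    (q := fun J => ∀ t ∈ J, |Q.eval t| < s) fun T _ hT hTs =>
    .piece le_rfl (ordConnected_abs_lt hT
      (monotoneOn_or_antitoneOn hT (fun t _ => Q.hasDerivAt t) hTs)) fun t ht => ht.2
  simpa using this

/-- The slice is cut until `norm_integral_exp_le` applies on every piece; `2 ≤ N` supplies the signs
of `h 1` and `h 2`. The sign of `Q'(h 0)` is obtained by pulling back a decomposition for `Q` along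
the monotone function `h 0`, so the number of pieces depends on `m` but not on the coefficients of
`P`. -/
theorem slice_oscillatory (A N m : ℕ) (hN : 2 ≤ N) : ∃ C : ℝ, 0 ≤ C ∧
    ∀ (S : Set ℝ) (h : ℕ → ℝ → ℝ), IsUnionOfIntervals A S → Bornology.IsBounded S →
      DerivChainOn h S → (∀ J ⊆ S, J.OrdConnected → SingleSignedOn (h N) J) →
      ∀ (P : Polynomial ℝ) (s η lam : ℝ), P.derivative.natDegree ≤ m → 0 < s → 0 < η → lam ≠ 0 →
      MeasurableSet {t ∈ S | η ≤ |h 1 t| ∧ s ≤ |P.derivative.eval (h 0 t)|} ∧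
      ‖∫ t in {t ∈ S | η ≤ |h 1 t| ∧ s ≤ |P.derivative.eval (h 0 t)|},
        Complex.exp (Complex.I * ((lam * P.eval (h 0 t) : ℝ) : ℂ))‖ ≤ C / (|lam| * s * η) := by
  refine ⟨(A * (2 ^ N * (2 * (2 ^ (m + 1) * 2))) : ℕ) * 6, by positivity, ?_⟩
  intro S h hS hSb hh hsgn P s η lam hP hs hη hlam
  set Q := P.derivative with hQ
  have hd : Decomp (fun T => (∀ t ∈ T, η ≤ |h 1 t| ∧ s ≤ |Q.eval (h 0 t)|) ∧
      SingleSignedOn (h 1) T ∧ SingleSignedOn (h 2) T ∧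
      SingleSignedOn (fun t => Q.derivative.eval (h 0 t)) T)
      (A * (2 ^ N * (2 * (2 ^ (m + 1) * 2))))
      {t ∈ S | η ≤ |h 1 t| ∧ s ≤ |Q.eval (h 0 t)|} := by
    refine hS.decomp.bind_sep fun I hIS hI _ => ?_
    refine (decomp_singleSigned N hI (hh.mono hIS) (hsgn I hIS hI)).bind_sep
      fun J hJI hJ hJs => ?_
    have hJS := hJI.trans hIS
    have hmono : ∀ i < N, MonotoneOn (h i) J ∨ AntitoneOn (h i) J := fun i hi =>
      monotoneOn_or_antitoneOn hJ (fun t ht => hh t (hJS ht) i) (hJs (i + 1) hi)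
    have h2 := (decomp_le_abs hη hJ (hmono 1 (by omega))).bind_sep (c := 2 ^ (m + 1) * 2)
      (P := fun t => s ≤ |Q.eval (h 0 t)|)
      (q := fun T => (∀ t ∈ T, η ≤ |h 1 t| ∧ s ≤ |Q.eval (h 0 t)|) ∧
        SingleSignedOn (h 1) T ∧ SingleSignedOn (h 2) T ∧
        SingleSignedOn (fun t => Q.derivative.eval (h 0 t)) T) fun T hT hTo _ => by
        have hTJ : T ⊆ J := fun t ht => (hT ht).1
        refine (decomp_polynomial_le_abs hP hs).inter_preimage (J := T) (g := h 0)
          fun R hR hRp => ⟨ordConnected_inter_preimage hTo hR ((hmono 0 (by omega)).imp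
            (fun h => h.mono hTJ) (fun h => h.mono hTJ)), fun t ht => ⟨(hT ht.1).2, hRp.1 _ ht.2⟩,
            (hJs 1 (by omega)).mono fun t ht => hTJ ht.1,
            (hJs 2 hN).mono fun t ht => hTJ ht.1, ?_⟩
        exact hRp.2.imp (fun H t ht => H _ ht.2) (fun H t ht => H _ ht.2)
    convert h2 using 1
    ext t; simp only [mem_ofPred_eq, and_assoc]
  refine ⟨hd.measurableSet, ?_⟩
  have hcont : ContinuousOn (fun t => Complex.exp (Complex.I * ((lam * P.eval (h 0 t) : ℝ) : ℂ)))
      S :=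
    Complex.continuous_exp.comp_continuousOn (continuousOn_const.mul
      (Complex.continuous_ofReal.comp_continuousOn (continuousOn_const.mul
        (P.continuous.comp_continuousOn (hh.continuousOn 0)))))
  have hfin : volume {t ∈ S | η ≤ |h 1 t| ∧ s ≤ |Q.eval (h 0 t)|} < ⊤ :=
    (hSb.subset fun t ht => ht.1).measure_lt_top
  have hInt : IntegrableOn (fun t => Complex.exp (Complex.I * ((lam * P.eval (h 0 t) : ℝ) : ℂ)))
      {t ∈ S | η ≤ |h 1 t| ∧ s ≤ |Q.eval (h 0 t)|} := by
    refine IntegrableOn.of_bound hfin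
      ((hcont.mono fun t ht => ht.1).aestronglyMeasurable hd.measurableSet) 1
      (Filter.Eventually.of_forall fun t => ?_)
    rw [mul_comm]; exact (Complex.norm_exp_ofReal_mul_I _).le
  rw [mul_div_assoc]
  refine hd.norm_setIntegral_le (by positivity) hInt fun T hT hTo hTp => ?_
  have hTS : T ⊆ S := fun t ht => (hT ht).1
  refine norm_setIntegral_le_of_Icc (by positivity) hTo (hSb.subset hTS) (hInt.mono_set hT)
    fun a b hab hsub => ?_
  exact norm_integral_exp_le hab (hh.mono (hsub.trans hTS)) hs hη hlam
    (fun t ht => (hTp.1 t (hsub ht)).1) (fun t ht => (hTp.1 t (hsub ht)).2)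
    (hTp.2.1.mono hsub) (hTp.2.2.1.mono hsub) (hTp.2.2.2.mono hsub)

/-! ### Lower bounds for monic and semi-non-degenerating polynomials -/

open Polynomial in
theorem mem_degreeLT_succ_iff {m : ℕ} {p : ℝ[X]} :
    p ∈ degreeLT ℝ (m + 1) ↔ p.natDegree ≤ m := by
  rw [mem_degreeLT, degree_lt_iff_coeff_zero, natDegree_le_iff_coeff_eq_zero]
  simp only [Nat.succ_le_iff]

open Polynomial in
theorem natDegree_comp_C_mul_X_le (p : ℝ[X]) (t : ℝ) :
    (p.comp (C t * X)).natDegree ≤ p.natDegree :=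
  natDegree_comp_le.trans (by
    simpa using Nat.mul_le_mul_left p.natDegree ((natDegree_C_mul_le t X).trans natDegree_X_le))

open Polynomial in
/-- On polynomials of bounded degree, any linear map without kernel controls the coefficients. -/
theorem exists_abs_coeff_le {W : Type*} [NormedAddCommGroup W] [NormedSpace ℝ W] (m : ℕ)
    (E : ℝ[X] →ₗ[ℝ] W) (hE : ∀ p : ℝ[X], p.natDegree ≤ m → E p = 0 → p = 0) :
    ∃ K : ℝ, 1 ≤ K ∧ ∀ p : ℝ[X], p.natDegree ≤ m → ∀ i, |p.coeff i| ≤ K * ‖E p‖ := by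
  let L : (Fin (m + 1) → ℝ) →ₗ[ℝ] W :=
    E ∘ₗ (degreeLT ℝ (m + 1)).subtype ∘ₗ (degreeLTEquiv ℝ (m + 1)).symm.toLinearMap
  have hker : LinearMap.ker L = ⊥ := by
    rw [LinearMap.ker_eq_bot']
    intro v hv
    have h0 := hE _ (mem_degreeLT_succ_iff.1 ((degreeLTEquiv ℝ (m + 1)).symm v).2) hv
    simpa using h0
  obtain ⟨K, hK, hL⟩ := L.exists_antilipschitzWith hker
  refine ⟨max K 1, le_max_right _ _, fun p hp i => ?_⟩
  rcases le_or_gt i m with hi | hi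
  · have hp' : p ∈ degreeLT ℝ (m + 1) := mem_degreeLT_succ_iff.2 hp
    set v := degreeLTEquiv ℝ (m + 1) ⟨p, hp'⟩ with hv
    have h1 : L v = E p := by simp [L, hv]
    have h2 : ‖v‖ ≤ K * ‖E p‖ := by
      have := hL.le_mul_dist v 0
      rwa [map_zero, dist_zero_right, dist_zero_right, h1] at this
    have h3 : p.coeff i = v ⟨i, Nat.lt_succ_of_le hi⟩ := by simp [hv, degreeLTEquiv]
    rw [h3, ← Real.norm_eq_abs]
    refine (norm_le_pi_norm v _).trans (h2.trans ?_)
    gcongr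
    exact le_max_left _ _
  · rw [coeff_eq_zero_of_natDegree_lt (hp.trans_lt hi), abs_zero]
    positivity

open Polynomial in
-- Values at the `m + 1` distinct nodes `i / (m + 1)` in `[0, 1]` determine a polynomial of degree
-- at most `m`.
theorem exists_abs_coeff_le_of_abs_eval_le (m : ℕ) : ∃ K : ℝ, 1 ≤ K ∧ ∀ (p : ℝ[X]) (s : ℝ),
    p.natDegree ≤ m → (∀ t ∈ Icc (0 : ℝ) 1, |p.eval t| ≤ s) → ∀ i, |p.coeff i| ≤ K * s := by
  obtain ⟨K, hK, H⟩ := exists_abs_coeff_le m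
    (LinearMap.pi fun i : Fin (m + 1) => Polynomial.leval ((i : ℝ) / (m + 1))) (by
      intro p hp h0
      have hinj : Function.Injective fun i : Fin (m + 1) => ((i : ℝ) / (m + 1)) := by
        intro i j hij
        have : ((m : ℝ) + 1) ≠ 0 := by positivity
        simpa [div_left_inj' this, Fin.ext_iff] using hij
      refine eq_zero_of_natDegree_lt_card_of_eval_eq_zero p hinj (fun i => ?_)
        (by simpa [Nat.lt_succ_iff] using hp)
      exact congrFun h0 i)
  refine ⟨K, hK, fun p s hp hs i => (H p hp i).trans ?_⟩
  gcongr
  refine (pi_norm_le_iff_of_nonneg ((abs_nonneg _).trans (hs 0 (by simp)))).2 fun i => ?_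
  refine hs _ ⟨by positivity, ?_⟩
  rw [div_le_one (by positivity)]
  exact_mod_cast i.2.le

open Polynomial in
-- Hermite interpolation at 0 and 1: a polynomial vanishing to order `r` at 0 and `q` at 1 is
-- divisible by `X^r (X - 1)^q`, whose degree exceeds `m`.
theorem exists_abs_coeff_le_of_hermite (m r q : ℕ) (h : m < r + q) : ∃ K : ℝ, 1 ≤ K ∧
    ∀ (p : ℝ[X]) (s : ℝ), p.natDegree ≤ m → 0 ≤ s → (∀ i < r, |p.coeff i| ≤ s) →
      (∀ i < q, |(taylor 1 p).coeff i| ≤ s) → ∀ i, |p.coeff i| ≤ K * s := by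
  obtain ⟨K, hK, H⟩ := exists_abs_coeff_le m
    ((LinearMap.pi fun i : Fin r => lcoeff ℝ (i : ℕ)).prod
      (LinearMap.pi fun i : Fin q => lcoeff ℝ (i : ℕ) ∘ₗ taylor 1)) (by
      intro p hp h0
      obtain ⟨h1, h2⟩ := Prod.mk_eq_zero.1 h0
      have d1 : X ^ r ∣ p := X_pow_dvd_iff.2 fun i hi => congrFun h1 ⟨i, hi⟩
      have d2 : (X - C 1) ^ q ∣ p := by
        rw [X_sub_C_pow_dvd_iff, ← taylor_apply]
        exact X_pow_dvd_iff.2 fun i hi => congrFun h2 ⟨i, hi⟩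
      have hcop : IsCoprime (X ^ r : ℝ[X]) ((X - C 1) ^ q) := by
        refine IsCoprime.pow ⟨1, -1, ?_⟩
        simp
      have d3 := hcop.mul_dvd d1 d2
      by_contra hp0
      have := natDegree_le_of_dvd d3 hp0
      rw [((monic_X_pow r).natDegree_mul ((monic_X_sub_C 1).pow q)), natDegree_X_pow,
        natDegree_pow, natDegree_X_sub_C] at this
      omega)
  refine ⟨K, hK, fun p s hp hs h1 h2 i => (H p hp i).trans ?_⟩
  gcongr
  refine (norm_prod_le_iff).2 ⟨(pi_norm_le_iff_of_nonneg hs).2 fun i => h1 i i.2,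
    (pi_norm_le_iff_of_nonneg hs).2 fun i => h2 i i.2⟩

open Polynomial in
theorem taylor_one_comp_C_mul_X (Q : ℝ[X]) (t : ℝ) :
    taylor 1 (Q.comp (C t * X)) = (taylor t Q).comp (C t * X) := by
  simp [taylor_apply, comp_assoc, mul_add]

open Polynomial in
/-- A monic or semi-non-degenerating polynomial has, at every point, some Taylor coefficient that
is bounded below. -/
theorem exists_le_abs_taylor_coeff (m : ℕ) : ∃ c : ℝ, 0 < c ∧ ∀ Q : ℝ[X], Q.natDegree = m →
    (Q.Monic ∨ IsSND Q) → ∀ t : ℝ, ∃ k ≤ m, c ≤ |(taylor t Q).coeff k| := by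
  have hK : ∀ j : ℕ, j ≤ m → ∃ K : ℝ, 1 ≤ K ∧
    ∀ (p : ℝ[X]) (s : ℝ), p.natDegree ≤ m → 0 ≤ s → (∀ i < m - j, |p.coeff i| ≤ s) →
      (∀ i < j + 1, |(taylor 1 p).coeff i| ≤ s) → ∀ i, |p.coeff i| ≤ K * s := fun j hj =>
    exists_abs_coeff_le_of_hermite m (m - j) (j + 1) (by omega)
  have hK' : ∃ K : ℝ, 1 ≤ K ∧ ∀ j ≤ m,
    ∀ (p : ℝ[X]) (s : ℝ), p.natDegree ≤ m → 0 ≤ s → (∀ i < m - j, |p.coeff i| ≤ s) →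
      (∀ i < j + 1, |(taylor 1 p).coeff i| ≤ s) → ∀ i, |p.coeff i| ≤ K * s := by
    choose! K hK1 hK using hK
    refine ⟨∑ j ∈ Finset.range (m + 1), K j, ?_, fun j hj p s hp hs h1 h2 i =>
      (hK j hj p s hp hs h1 h2 i).trans ?_⟩
    · refine (hK1 0 m.zero_le).trans (Finset.single_le_sum (f := K) (fun j hj => ?_) (by simp))
      exact zero_le_one.trans (hK1 j (by simpa [Nat.lt_succ_iff] using hj))
    · gcongr
      refine Finset.single_le_sum (f := K) (fun j hj => ?_) (by simpa [Nat.lt_succ_iff] using hj)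
      exact zero_le_one.trans (hK1 j (by simpa [Nat.lt_succ_iff] using hj))
  obtain ⟨K, hK1, hK⟩ := hK'
  obtain ⟨K₂, hK₂1, hK₂⟩ := exists_abs_coeff_le_of_abs_eval_le m
  have hK0 : 0 < K := by linarith
  have hK₂0 : 0 < K₂ := by linarith
  set B : ℝ := K₂ * ((m + 1) * (1 + 2 * K) ^ m) with hB
  have hB0 : 0 < B := by positivity
  -- The three terms serve, in order, SND with `|t| ≥ 2K`, SND with `|t| < 2K`, and the monic case,
  -- where the top Taylor coefficient is 1.
  refine ⟨min (1 / (2 * K)) (min (1 / (2 * B)) 1), by positivity, fun Q hQ hQ' t => ?_⟩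
  set c := min (1 / (2 * K)) (min (1 / (2 * B)) 1)
  have hc0 : 0 < c := by positivity
  have hcK : K * c ≤ 1 / 2 := by
    calc K * c ≤ K * (1 / (2 * K)) := by gcongr; exact min_le_left _ _
      _ = 1 / 2 := by field_simp
  have hcB : B * c ≤ 1 / 2 := by
    calc B * c ≤ B * (1 / (2 * B)) := by
          gcongr; exact (min_le_right _ _).trans (min_le_left _ _)
      _ = 1 / 2 := by field_simp
  have hc1 : c ≤ 1 := (min_le_right _ _).trans (min_le_right _ _)
  rcases hQ' with hmon | ⟨hle, j, hj, hone⟩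
  · refine ⟨m, le_rfl, ?_⟩
    rw [← hQ, coeff_taylor_natDegree, hmon.leadingCoeff]
    simpa using hc1
  by_contra! hcon
  rw [hQ] at hj hone
  rcases le_or_gt (2 * K) |t| with ht | ht
  · have ht0 : 0 < |t| := by linarith
    have ht1 : 1 ≤ |t| := by linarith
    -- Rescaling moves `t` to 1. The coefficients of `p` below `m - j` are at most `|t|^(m-j-1)`.
    -- Its first `j + 1` Taylor coefficients at 1 are at most `c |t|^j`, and `j ≤ m - j` is exactly
    -- the SND condition. Both are at most `|t|^(m-j) / (2K)`, so the Hermite bound contradicts the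
    -- coefficient of size `|t|^(m-j)` in degree `m - j`.
    set p := Q.comp (C t * X) with hp
    have hpd : p.natDegree ≤ m := (natDegree_comp_C_mul_X_le Q t).trans hQ.le
    have := hK j (by omega) p (|t| ^ (m - j) * (1 / (2 * K))) hpd (by positivity) (fun i hi => ?_)
      (fun i hi => ?_) (m - j)
    · rw [hp, comp_C_mul_X_coeff, abs_mul, hone, one_mul, abs_pow] at this
      have h5 : K * (|t| ^ (m - j) * (1 / (2 * K))) = |t| ^ (m - j) / 2 := by field_simp
      rw [h5] at this
      have : 0 < |t| ^ (m - j) := by positivity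
      linarith
    · rw [hp, comp_C_mul_X_coeff, abs_mul, abs_pow]
      calc |Q.coeff i| * |t| ^ i ≤ 1 * |t| ^ (m - j - 1) := by
            refine mul_le_mul (hle i) (pow_le_pow_right₀ ht1 (by omega)) (by positivity) zero_le_one
        _ = |t| ^ (m - j) * (1 / |t|) := by
            obtain ⟨e, he⟩ : ∃ e, m - j = e + 1 := ⟨m - j - 1, by omega⟩
            rw [he, pow_succ]; field_simp; simp
        _ ≤ _ := by gcongr
    · rw [hp, taylor_one_comp_C_mul_X, comp_C_mul_X_coeff, abs_mul, abs_pow, mul_comm]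
      refine mul_le_mul (pow_le_pow_right₀ ht1 (by omega)) ?_ (abs_nonneg _) (by positivity)
      exact (hcon i (by omega)).le.trans (min_le_left _ _)
  -- For bounded `t`, small Taylor coefficients at `t` make `Q` small on `[0, 1]`, hence all its
  -- coefficients smaller than 1.
  · have h1 := hK₂ Q (((m : ℝ) + 1) * (c * (1 + 2 * K) ^ m)) hQ.le (fun x hx => ?_) (m - j)
    · rw [hone] at h1
      have : K₂ * (((m : ℝ) + 1) * (c * (1 + 2 * K) ^ m)) = B * c := by rw [hB]; ring
      linarith
    · have h2 : Q.eval x = (taylor t Q).eval (x - t) := by simp [taylor_eval]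
      rw [h2, eval_eq_sum_range, natDegree_taylor, hQ]
      refine (Finset.abs_sum_le_sum_abs _ _).trans ?_
      have h3 : ∀ i ∈ Finset.range (m + 1), |(taylor t Q).coeff i * (x - t) ^ i| ≤
          c * (1 + 2 * K) ^ m := by
        intro i hi
        have hi' : i ≤ m := by simpa [Nat.lt_succ_iff] using hi
        rw [abs_mul, abs_pow]
        have h4 : |x - t| ≤ 1 + 2 * K := by
          refine (abs_sub _ _).trans ?_
          rw [abs_of_nonneg hx.1]
          linarith [hx.2]
        refine mul_le_mul (hcon i hi').le ?_ (by positivity) hc0.le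
        calc |x - t| ^ i ≤ (1 + 2 * K) ^ i := by gcongr
          _ ≤ _ := pow_le_pow_right₀ (by linarith) hi'
      refine (Finset.sum_le_card_nsmul _ _ _ h3).trans ?_
      simp

open Polynomial in
/-- An interval on which a monic or semi-non-degenerating polynomial of degree `m` is smaller
than a multiple of `ε ^ m` is shorter than `ε`. -/
theorem exists_le_abs_eval (m : ℕ) : ∃ c : ℝ, 0 < c ∧ ∀ Q : ℝ[X], Q.natDegree = m →
    (Q.Monic ∨ IsSND Q) → ∀ ε : ℝ, 0 < ε → ε ≤ 1 → ∀ a : ℝ,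
    ∃ t ∈ Icc a (a + ε), c * ε ^ m ≤ |Q.eval t| := by
  obtain ⟨c, hc, H⟩ := exists_le_abs_taylor_coeff m
  obtain ⟨K, hK1, hK⟩ := exists_abs_coeff_le_of_abs_eval_le m
  have hK0 : 0 < K := by linarith
  refine ⟨c / (2 * K), by positivity, fun Q hQ hQ' ε hε hε1 a => ?_⟩
  by_contra! hcon
  obtain ⟨k, hk, hck⟩ := H Q hQ hQ' a
  -- With `[a, a + ε]` rescaled to `[0, 1]`, the `k`-th coefficient is at least `c ε^k ≥ c ε^m` in
  -- absolute value, because `k ≤ m` and `ε ≤ 1`.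
  have h1 := hK ((taylor a Q).comp (C ε * X)) (c / (2 * K) * ε ^ m)
    ((natDegree_comp_C_mul_X_le _ _).trans (by rw [natDegree_taylor, hQ]))
    (fun t ht => ?_) k
  · rw [comp_C_mul_X_coeff, abs_mul, abs_of_pos (pow_pos hε k)] at h1
    have h2 : c * ε ^ m ≤ |(taylor a Q).coeff k| * ε ^ k :=
      mul_le_mul hck (pow_le_pow_of_le_one hε.le hε1 hk) (by positivity) (abs_nonneg _)
    have h3 : K * (c / (2 * K) * ε ^ m) = c * ε ^ m / 2 := by field_simp
    have : 0 < c * ε ^ m := by positivity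
    linarith
  · have : ((taylor a Q).comp (C ε * X)).eval t = Q.eval (a + ε * t) := by
      simp [taylor_eval, add_comm]
    rw [this]
    refine (hcon _ ⟨?_, ?_⟩).le
    · nlinarith [mul_nonneg hε.le ht.1]
    · nlinarith [mul_le_mul_of_nonneg_left ht.2 hε.le]

/-! ### Mixed partial derivatives and restriction to coordinate lines -/

variable {n : ℕ}

theorem contDiffOn_pderiv {U : Set (EuclideanSpace ℝ (Fin n))} (hU : IsOpen U)
    {f : EuclideanSpace ℝ (Fin n) → ℝ} (hf : ContDiffOn ℝ ∞ f U) (j : Fin n) :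
    ContDiffOn ℝ ∞ (pderiv j f) U :=
  (hf.fderiv_of_isOpen hU (m := ∞) (by simp)).clm_apply contDiffOn_const

theorem contDiffOn_iterate_pderiv {U : Set (EuclideanSpace ℝ (Fin n))} (hU : IsOpen U)
    {f : EuclideanSpace ℝ (Fin n) → ℝ} (hf : ContDiffOn ℝ ∞ f U) (j : Fin n) (i : ℕ) :
    ContDiffOn ℝ ∞ ((pderiv j)^[i] f) U := by
  induction i with
  | zero => exact hf
  | succ i ih => rw [Function.iterate_succ_apply']; exact contDiffOn_pderiv hU ih j

theorem contDiffOn_mderiv {U : Set (EuclideanSpace ℝ (Fin n))} (hU : IsOpen U)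
    {f : EuclideanSpace ℝ (Fin n) → ℝ} (hf : ContDiffOn ℝ ∞ f U) (β : Fin n → ℕ) :
    ContDiffOn ℝ ∞ (mderiv β f) U := by
  unfold mderiv
  induction List.finRange n with
  | nil => exact hf
  | cons j l ih => exact contDiffOn_iterate_pderiv hU ih j _

/-- Since `β` vanishes before `j`, the derivatives in direction `j` are the outermost ones that act,
so they can be pulled out without commuting partial derivatives. -/
theorem foldr_pderiv_eq {β γ : Fin n → ℕ} (f : EuclideanSpace ℝ (Fin n) → ℝ) (j : Fin n)
    (hβ : ∀ i < j, β i = 0) (hγ : ∀ i ≤ j, γ i = 0) (h : ∀ i, j < i → γ i = β i) :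
    ∀ l : List (Fin n), l.Pairwise (· < ·) → j ∈ l →
      l.foldr (fun j g => (pderiv j)^[β j] g) f =
        (pderiv j)^[β j] (l.foldr (fun j g => (pderiv j)^[γ j] g) f) := by
  intro l
  induction l with
  | nil => intro _ hj; simp at hj
  | cons a l ih =>
    intro hl hj
    rw [List.pairwise_cons] at hl
    simp only [List.foldr_cons]
    rcases List.mem_cons.1 hj with rfl | hj'
    · rw [hγ j le_rfl, Function.iterate_zero, id]
      congr 1
      refine List.foldr_ext _ _ _ fun i hi g => ?_
      rw [h i (hl.1 i hi)]
    · have ha := hl.1 j hj'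
      rw [hβ a ha, hγ a ha.le, Function.iterate_zero, id, id]
      exact ih hl.2 hj'

theorem mderiv_eq_iterate_pderiv {β γ : Fin n → ℕ} (f : EuclideanSpace ℝ (Fin n) → ℝ) (j : Fin n)
    (hβ : ∀ i < j, β i = 0) (hγ : ∀ i ≤ j, γ i = 0) (h : ∀ i, j < i → γ i = β i) :
    mderiv β f = (pderiv j)^[β j] (mderiv γ f) :=
  foldr_pderiv_eq f j hβ hγ h _ (List.pairwise_lt_finRange n) (List.mem_finRange j)

theorem mderiv_zero (f : EuclideanSpace ℝ (Fin n) → ℝ) : mderiv 0 f = f := by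
  unfold mderiv
  induction List.finRange n with
  | nil => rfl
  | cons j l ih => exact ih

/-- The part of the multiindex `β` in positions `≥ j`. -/
def tailPart (β : Fin n → ℕ) (j : ℕ) : Fin n → ℕ := fun i => if j ≤ (i : ℕ) then β i else 0

theorem mderiv_tailPart_eq (β : Fin n → ℕ) (f : EuclideanSpace ℝ (Fin n) → ℝ) (j : Fin n) :
    mderiv (tailPart β j) f = (pderiv j)^[β j] (mderiv (tailPart β (j + 1)) f) := by
  have := mderiv_eq_iterate_pderiv (β := tailPart β j) (γ := tailPart β (j + 1)) f j
    (fun i hi => by simp [tailPart, hi]) (fun i hi => by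
      have : (i : ℕ) ≤ j := hi
      simp only [tailPart]; rw [if_neg (by omega)])
    (fun i hi => by
      have : (j : ℕ) < i := hi
      simp only [tailPart]; rw [if_pos (by omega), if_pos (by omega)])
  rwa [show tailPart β j j = β j by simp [tailPart]] at this

theorem mderiv_tailIndex_eq (β N : Fin n → ℕ) (f : EuclideanSpace ℝ (Fin n) → ℝ) (j : Fin n) :
    mderiv (tailIndex β N j) f = (pderiv j)^[N j] (mderiv (tailPart β (j + 1)) f) := by
  have := mderiv_eq_iterate_pderiv (β := tailIndex β N j) (γ := tailPart β (j + 1)) f j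
    (fun i hi => by simp [tailIndex, hi]) (fun i hi => by
      have : (i : ℕ) ≤ j := hi
      simp only [tailPart]; rw [if_neg (by omega)])
    (fun i hi => by
      have : (j : ℕ) < i := hi
      simp only [tailPart, tailIndex]
      rw [if_pos (by omega), if_neg (not_lt.2 hi.le), if_neg hi.ne'])
  rwa [show tailIndex β N j j = N j by simp [tailIndex]] at this

theorem tailPart_zero (β : Fin n → ℕ) : tailPart β 0 = β := by
  ext i; simp [tailPart]

theorem tailPart_self (β : Fin n → ℕ) : tailPart β n = 0 := by
  ext i; simp [tailPart]

theorem hasDerivAt_toLp_update (x : Fin n → ℝ) (j : Fin n) (t : ℝ) :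
    HasDerivAt (fun t => (WithLp.toLp 2 (Function.update x j t) : EuclideanSpace ℝ (Fin n)))
      (EuclideanSpace.single j 1) t :=
  ((EuclideanSpace.equiv (Fin n) ℝ).symm.hasFDerivAt.comp_hasDerivAt t (hasDerivAt_update x j t))

/-- The iterated partial derivatives in direction `j`, restricted to a line in that direction. -/
theorem derivChainOn_slice {U X : Set (EuclideanSpace ℝ (Fin n))} (hU : IsOpen U) (hX : X ⊆ U)
    {g : EuclideanSpace ℝ (Fin n) → ℝ} (hg : ContDiffOn ℝ ∞ g U) (j : Fin n) (x : Fin n → ℝ) :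
    DerivChainOn (fun i t => (pderiv j)^[i] g (WithLp.toLp 2 (Function.update x j t)))
      {t : ℝ | WithLp.toLp 2 (Function.update x j t) ∈ X} := by
  intro t ht i
  have hd : DifferentiableAt ℝ ((pderiv j)^[i] g) (WithLp.toLp 2 (Function.update x j t)) :=
    ((contDiffOn_iterate_pderiv hU hg j i).contDiffAt (hU.mem_nhds (hX ht))).differentiableAt
      (by simp)
  have := hd.hasFDerivAt.comp_hasDerivAt t (hasDerivAt_toLp_update x j t)
  simp only [Function.iterate_succ_apply']
  exact this

/-! ### Fubini bounds from slices -/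

/-- Fubini bound: a function supported in a box of side `2 D`, whose integrals along all lines in
direction `j` are at most `M`, has integral at most `M (2 D) ^ (n - 1)`. -/
theorem norm_integral_le_of_slices (j : Fin n) (G : EuclideanSpace ℝ (Fin n) → ℂ) (x₀ : Fin n → ℝ)
    {D M : ℝ} (hD : 0 ≤ D) (hsupp : ∀ x, G x ≠ 0 → ∀ i, |x i - x₀ i| ≤ D)
    (hM : ∀ x : Fin n → ℝ, ‖∫ t, G (WithLp.toLp 2 (Function.update x j t))‖ ≤ M) :
    ‖∫ x, G x‖ ≤ M * (2 * D) ^ (n - 1) := by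
  have hM0 : 0 ≤ M := (norm_nonneg _).trans (hM 0)
  rcases n with _ | m
  · exact j.elim0
  by_cases hG : Integrable G
  swap
  · rw [integral_undef hG, norm_zero]; positivity
  have e1 := (EuclideanSpace.volume_preserving_symm_measurableEquiv_toLp (Fin (m + 1))).symm
  have e2 := (volume_preserving_piFinSuccAbove (fun _ : Fin (m + 1) => ℝ) j).symm
  have e := e1.comp e2
  set φ : ℝ × (Fin m → ℝ) → EuclideanSpace ℝ (Fin (m + 1)) :=
    fun z => WithLp.toLp 2 (j.insertNth z.1 z.2) with hφ
  have heq : ∫ x, G x = ∫ z : ℝ × (Fin m → ℝ), G (φ z) := by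
    exact ((e.integral_comp ((MeasurableEquiv.measurableEmbedding _).comp
      (MeasurableEquiv.measurableEmbedding _)) G)).symm
  have hInt : Integrable (fun z => G (φ z)) (volume.prod volume) :=
    (e.integrable_comp_emb ((MeasurableEquiv.measurableEmbedding _).comp
      (MeasurableEquiv.measurableEmbedding _))).2 hG
  rw [heq]
  change ‖∫ z, G (φ z) ∂(volume.prod volume)‖ ≤ _
  rw [integral_prod_symm _ hInt]
  set y₀ : Fin m → ℝ := fun i => x₀ (j.succAbove i)
  set B : Set (Fin m → ℝ) := Icc (fun i => y₀ i - D) (fun i => y₀ i + D) with hB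
  -- Outside the box `B` of the remaining `n - 1` coordinates the whole line misses the support, so
  -- the outer integral runs over a set of volume `(2 D)^(n-1)`.
  have hout : ∀ y ∉ B, ∫ t, G (φ (t, y)) = 0 := by
    intro y hy
    refine integral_eq_zero_of_ae (Filter.Eventually.of_forall fun t => ?_)
    by_contra hne
    refine hy ⟨fun i => ?_, fun i => ?_⟩ <;>
    · have := abs_le.1 (hsupp _ hne (j.succAbove i))
      simp only [hφ, Fin.insertNth_apply_succAbove] at this
      simp only [y₀]
      linarith [this.1, this.2]
  rw [← setIntegral_eq_integral_of_forall_compl_eq_zero hout]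
  have hvol : volume B = ENNReal.ofReal ((2 * D) ^ m) := by
    rw [hB, Real.volume_Icc_pi, ENNReal.ofReal_pow (by positivity)]
    simp [add_sub_sub_cancel, ← two_mul]
  have := norm_setIntegral_le_of_norm_le_const (μ := volume) (s := B) (C := M)
    (f := fun y => ∫ t, G (φ (t, y))) (by rw [hvol]; exact ENNReal.ofReal_lt_top) fun y _ => by
      have := hM (j.insertNth 0 y)
      simpa using this
  simpa [Measure.real, hvol, ENNReal.toReal_ofReal (show 0 ≤ (2 * D) ^ m by positivity)] using this

theorem measure_lt_top_of_abs_sub_le {S : Set (EuclideanSpace ℝ (Fin n))} {x₀ : Fin n → ℝ} {D : ℝ}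
    (hsupp : ∀ x ∈ S, ∀ i, |x i - x₀ i| ≤ D) : volume S < ⊤ := by
  have hsub : S ⊆ (MeasurableEquiv.toLp 2 (Fin n → ℝ)).symm ⁻¹'
      Icc (fun i => x₀ i - D) (fun i => x₀ i + D) := by
    intro x hx
    refine ⟨fun i => ?_, fun i => ?_⟩ <;>
    · have := abs_le.1 (hsupp x hx i)
      simp only [MeasurableEquiv.toLp_symm_apply]
      linarith [this.1, this.2]
  refine (measure_mono hsub).trans_lt ?_
  rw [(EuclideanSpace.volume_preserving_symm_measurableEquiv_toLp (Fin n)).measure_preimage_equiv]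
  exact isCompact_Icc.measure_lt_top

theorem measure_le_of_slices (j : Fin n) {S : Set (EuclideanSpace ℝ (Fin n))}
    (hS : NullMeasurableSet S volume) {x₀ : Fin n → ℝ} {D M : ℝ} (hD : 0 ≤ D) (hM0 : 0 ≤ M)
    (hsupp : ∀ x ∈ S, ∀ i, |x i - x₀ i| ≤ D)
    (hM : ∀ x : Fin n → ℝ,
      volume {t : ℝ | WithLp.toLp 2 (Function.update x j t) ∈ S} ≤ ENNReal.ofReal M) :
    volume S ≤ ENNReal.ofReal (M * (2 * D) ^ (n - 1)) := by
  have hfin := measure_lt_top_of_abs_sub_le hsupp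
  have h := norm_integral_le_of_slices j (S.indicator fun _ => (1 : ℂ)) x₀ hD (M := M)
    (fun x hx => hsupp x (by by_contra h; simp [h] at hx)) (fun x => by
      refine (norm_integral_le_lintegral_norm _).trans ?_
      refine ENNReal.toReal_le_of_le_ofReal hM0 (le_trans ?_ (hM x))
      refine le_trans (lintegral_mono fun t => ?_) (lintegral_indicator_one_le _)
      by_cases ht : WithLp.toLp 2 (Function.update x j t) ∈ S <;> simp [indicator, ht])
  rw [integral_indicator₀ hS, setIntegral_const] at h
  have h' : volume.real S ≤ M * (2 * D) ^ (n - 1) := (le_abs_self _).trans (by simpa using h)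
  rw [← ENNReal.ofReal_toReal hfin.ne]
  exact ENNReal.ofReal_le_ofReal h'

theorem measure_le_of_abs_sub_le (j : Fin n) {S : Set (EuclideanSpace ℝ (Fin n))}
    (hS : NullMeasurableSet S volume) {x₀ : Fin n → ℝ} {D : ℝ} (hD : 0 ≤ D)
    (hsupp : ∀ x ∈ S, ∀ i, |x i - x₀ i| ≤ D) :
    volume S ≤ ENNReal.ofReal ((2 * D) ^ n) := by
  have hn : n - 1 + 1 = n := Nat.sub_add_cancel (Nat.one_le_of_lt j.2)
  have := measure_le_of_slices j hS hD (M := 2 * D) (by positivity) hsupp fun x => by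
    refine (measure_mono (t := Icc (x₀ j - D) (x₀ j + D)) fun t ht => ?_).trans ?_
    · have := abs_le.1 (hsupp _ ht j)
      simp only [Function.update_self] at this
      exact ⟨by linarith [this.1], by linarith [this.2]⟩
    · rw [Real.volume_Icc]
      exact ENNReal.ofReal_le_ofReal (by linarith)
  rwa [mul_comm, ← pow_succ, hn] at this

theorem nullMeasurableSet_abs_lt {E : Type*} [TopologicalSpace E] [MeasurableSpace E]
    [OpensMeasurableSpace E] {μ : Measure E} {X U : Set E} (hX : NullMeasurableSet X μ)
    (hU : IsOpen U) (hXU : X ⊆ U) {F : E → ℝ} (hF : ContinuousOn F U) (δ : ℝ) :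
    NullMeasurableSet {x ∈ X | |F x| < δ} μ := by
  have : {x ∈ X | |F x| < δ} = X ∩ (U ∩ F ⁻¹' Ioo (-δ) δ) := by
    ext x
    simp only [mem_ofPred_eq, mem_inter_iff, mem_preimage, mem_Ioo, abs_lt]
    exact ⟨fun h => ⟨h.1, hXU h.1, h.2⟩, fun h => ⟨h.1, h.2.2⟩⟩
  rw [this]
  exact hX.inter (hF.isOpen_inter_preimage hU isOpen_Ioo).measurableSet.nullMeasurableSet

theorem nullMeasurableSet_le_abs {E : Type*} [TopologicalSpace E] [MeasurableSpace E]
    [OpensMeasurableSpace E] {μ : Measure E} {X U : Set E} (hX : NullMeasurableSet X μ)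
    (hU : IsOpen U) (hXU : X ⊆ U) {F : E → ℝ} (hF : ContinuousOn F U) (δ : ℝ) :
    NullMeasurableSet {x ∈ X | δ ≤ |F x|} μ := by
  have : {x ∈ X | δ ≤ |F x|} = X \ {x ∈ X | |F x| < δ} := by
    ext x
    simp only [mem_ofPred_eq, mem_sdiff, not_and, not_lt]
    exact ⟨fun h => ⟨h.1, fun _ => h.2⟩, fun h => ⟨h.1, h.2 h.1⟩⟩
  rw [this]
  exact hX.diff (nullMeasurableSet_abs_lt hX hU hXU hF δ)

theorem singleSignedOn_of_abs_pos {g : ℝ → ℝ} {J : Set ℝ} (hJ : J.OrdConnected)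
    (hg : ContinuousOn g J) (h : ∀ t ∈ J, 0 < |g t|) : SingleSignedOn g J := by
  unfold SingleSignedOn
  by_contra! hcon
  obtain ⟨⟨x, hx, hx0⟩, y, hy, hy0⟩ := hcon
  obtain ⟨z, hz, hz0⟩ := hJ.isPreconnected.intermediate_value hx hy hg ⟨hx0.le, hy0.le⟩
  exact (h z hz).ne' (by rw [hz0, abs_zero])

/-! ### The sublevel estimate in several variables -/

/-- The sum of the entries of `β` in positions `< j`. -/
def headWeight (β : Fin n → ℕ) (j : ℕ) : ℕ := ∑ i : Fin n, if (i : ℕ) < j then β i else 0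

theorem headWeight_zero (β : Fin n → ℕ) : headWeight β 0 = 0 := by simp [headWeight]

theorem headWeight_self (β : Fin n → ℕ) : headWeight β n = ∑ i, β i := by simp [headWeight]

theorem headWeight_succ (β : Fin n → ℕ) (j : Fin n) :
    headWeight β (j + 1) = headWeight β j + β j := by
  unfold headWeight
  have : ∀ i : Fin n, (if (i : ℕ) < j + 1 then β i else 0) =
      (if (i : ℕ) < j then β i else 0) + if i = j then β i else 0 := by
    intro i
    rcases lt_trichotomy i j with h | h | h
    · have : (i : ℕ) < j := h
      simp [this, h.ne, Nat.lt_succ_of_lt this]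
    · simp [h]
    · have : (j : ℕ) < i := h
      rw [if_neg (by omega), if_neg (by omega), if_neg h.ne']
  simp only [this, Finset.sum_add_distrib, Finset.sum_ite_eq', Finset.mem_univ, if_true]

theorem sum_ne_zero {β : Fin n → ℕ} (hβ : β ≠ 0) : (∑ i, β i) ≠ 0 := fun h =>
  hβ (funext fun i => by simpa using (Finset.sum_eq_zero_iff.1 h i (Finset.mem_univ i)))

/-- The functions `T j` interpolate between `T 0 = ∂^β g`, nowhere below 1 in absolute value on `X`,
and `T n = g`; consecutive ones differ by `β j` derivatives in direction `j`. A point with `|g| < δ`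
must drop below the threshold at some step, and each step is estimated on lines. -/
theorem sublevel_estimate (A : ℕ) (β N : Fin n → ℕ) (hβ : β ≠ 0)
    (hN : ∀ j : Fin n, 0 < (j : ℕ) → β j ≠ 0 → β j < N j) : ∃ C : ℝ, 0 ≤ C ∧
    ∀ (X U : Set (EuclideanSpace ℝ (Fin n))) (g : EuclideanSpace ℝ (Fin n) → ℝ) (x₀ : Fin n → ℝ)
      (D : ℝ), NullMeasurableSet X volume → 0 ≤ D → (∀ x ∈ X, ∀ i, |x i - x₀ i| ≤ D) →
      (∀ j, β j ≠ 0 → SlicesIn j A X) → IsOpen U → X ⊆ U → ContDiffOn ℝ ∞ g U →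
      (∀ x ∈ X, 1 ≤ |mderiv β g x|) →
      (∀ j : Fin n, 0 < (j : ℕ) → β j ≠ 0 → SingleSignedOn (mderiv (tailIndex β N j) g) X) →
      ∀ δ : ℝ, 0 < δ → volume {x ∈ X | |g x| < δ} ≤
        ENNReal.ofReal (C * (2 * D) ^ (n - 1) * δ ^ (1 / ((∑ i, β i : ℕ) : ℝ))) := by
  have hB := sum_ne_zero hβ
  -- No sign hypothesis is available in the first direction. There `|∂^β g| ≥ 1` on all of `X` fixes
  -- the sign of the derivative of order `β 0` on each interval of a slice, so that order itself
  -- plays the role of `N`.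
  let N' : Fin n → ℕ := fun j => if (j : ℕ) = 0 then β j else N j
  have hN' : ∀ j, β j ≠ 0 → β j ≤ N' j := by
    intro j hj
    by_cases h0 : (j : ℕ) = 0
    · simp [N', h0]
    · simp only [N', h0, if_false]
      exact (hN j (Nat.pos_of_ne_zero h0) hj).le
  have hC : ∀ j : Fin n, ∃ C : ℝ, 0 ≤ C ∧ (β j ≠ 0 →
      ∀ (S : Set ℝ) (h : ℕ → ℝ → ℝ), IsUnionOfIntervals A S → DerivChainOn h S →
      (∀ J ⊆ S, J.OrdConnected → SingleSignedOn (h (N' j)) J) → ∀ δ δ' : ℝ, 0 < δ → 0 < δ' →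
      (β j < N' j ∨ ∀ t ∈ S, δ' ≤ |h (β j) t|) →
      volume {t ∈ S | δ' ≤ |h (β j) t| ∧ |h 0 t| < δ} ≤
        ENNReal.ofReal (C * (δ / δ') ^ (1 / (β j : ℝ)))) := by
    intro j
    by_cases hj : β j = 0
    · exact ⟨0, le_rfl, fun h => absurd hj h⟩
    · obtain ⟨C, hC, H⟩ := slice_sublevel A (β j) (N' j) (Nat.one_le_iff_ne_zero.2 hj) (hN' j hj)
      exact ⟨C, hC, fun _ => H⟩
  choose C hC0 hC using hC
  refine ⟨n * ∑ j, C j, mul_nonneg (Nat.cast_nonneg _) (Finset.sum_nonneg fun j _ => hC0 j), ?_⟩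
  intro X U g x₀ D hX hD hbox hsl hU hXU hg hge hsgn δ hδ
  set b : ℝ := ((∑ i, β i : ℕ) : ℝ) with hb
  have hb0 : b ≠ 0 := by rw [hb]; exact_mod_cast hB
  set M : ℝ := (∑ j, C j) * (2 * D) ^ (n - 1) * δ ^ (1 / b) with hM
  have hsum0 : 0 ≤ ∑ j, C j := Finset.sum_nonneg fun j _ => hC0 j
  let T : ℕ → EuclideanSpace ℝ (Fin n) → ℝ := fun j => mderiv (tailPart β j) g
  -- These thresholds run from 1 to `δ` and satisfy `(w (j + 1) / w j)^(1 / β j) = δ^(1 / b)`, so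
  -- all steps cost the same.
  let w : ℕ → ℝ := fun j => δ ^ ((headWeight β j : ℝ) / b)
  have hw : ∀ j, 0 < w j := fun j => Real.rpow_pos_of_pos hδ _
  have hTc : ∀ j, ContDiffOn ℝ ∞ (T j) U := fun j => contDiffOn_mderiv hU hg _
  have hstep : ∀ j : Fin n, volume {x ∈ X | w j ≤ |T j x| ∧ |T (j + 1) x| < w (j + 1)} ≤
      ENNReal.ofReal M := by
    intro j
    have hTj : T j = (pderiv j)^[β j] (T (j + 1)) := mderiv_tailPart_eq β g j
    by_cases hj : β j = 0
    · have h1 : T j = T (j + 1) := by rw [hTj, hj, Function.iterate_zero, id]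
      have h2 : w j = w (j + 1) := by simp only [w, headWeight_succ, hj, add_zero]
      have h3 : {x ∈ X | w j ≤ |T j x| ∧ |T (j + 1) x| < w (j + 1)} = ∅ := by
        rw [h1, h2]
        ext x
        simp only [mem_ofPred_eq, mem_empty_iff_false, iff_false]
        rintro ⟨-, h, h'⟩
        exact absurd h (not_le.2 h')
      rw [h3]; simp
    · have hnull : NullMeasurableSet {x ∈ X | w j ≤ |T j x| ∧ |T (j + 1) x| < w (j + 1)}
          volume := by
        have := (nullMeasurableSet_le_abs hX hU hXU (hTc j).continuousOn (w j)).inter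
          (nullMeasurableSet_abs_lt hX hU hXU (hTc (j + 1)).continuousOn (w (j + 1)))
        convert this using 1
        ext x
        simp only [mem_ofPred_eq, mem_inter_iff]
        tauto
      have hpow : (w (j + 1) / w j) ^ (1 / (β j : ℝ)) = δ ^ (1 / b) := by
        have hj' : (β j : ℝ) ≠ 0 := by exact_mod_cast hj
        simp only [w]
        rw [← Real.rpow_sub hδ, ← Real.rpow_mul hδ.le, headWeight_succ]
        congr 1
        push_cast
        field_simp
        ring
      have hslice := measure_le_of_slices j hnull hD (M := C j * δ ^ (1 / b))
        (mul_nonneg (hC0 j) (by positivity)) (x₀ := x₀) (fun x hx => hbox x hx.1) fun x => by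
          have := hC j hj {t : ℝ | WithLp.toLp 2 (Function.update x j t) ∈ X}
            (fun i t => (pderiv j)^[i] (T (j + 1)) (WithLp.toLp 2 (Function.update x j t)))
            (hsl j hj x) (derivChainOn_slice hU hXU (hTc (j + 1)) j x) ?_
            (w (j + 1)) (w j) (hw _) (hw _) ?_
          · rw [hpow] at this
            simp only [← hTj] at this
            exact this
          · intro J hJS hJ
            by_cases h0 : (j : ℕ) = 0
            · have hch := derivChainOn_slice hU hXU (hTc (j + 1)) j x
              refine singleSignedOn_of_abs_pos hJ ((hch.mono hJS).continuousOn _) fun t ht => ?_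
              have h1 := hge _ (hJS ht)
              have h2 : N' j = β j := by simp [N', h0]
              rw [h2]
              simp only [← hTj]
              simp only [T, h0, tailPart_zero]
              linarith
            · have h1 := hsgn j (Nat.pos_of_ne_zero h0) hj
              rw [mderiv_tailIndex_eq] at h1
              have h2 : N' j = N j := by simp [N', h0]
              rw [h2]
              exact h1.imp (fun H t ht => H _ (hJS ht)) (fun H t ht => H _ (hJS ht))
          · by_cases h0 : (j : ℕ) = 0
            · right
              intro t ht
              simp only [← hTj]
              simp only [T, h0, tailPart_zero, w, headWeight_zero]
              simpa using hge _ ht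
            · left
              simp only [N', h0, if_false]
              exact hN j (Nat.pos_of_ne_zero h0) hj
      refine hslice.trans (ENNReal.ofReal_le_ofReal ?_)
      rw [hM, mul_right_comm]
      gcongr
      exact Finset.single_le_sum (fun i _ => hC0 i) (Finset.mem_univ j)
  have hind : ∀ j : ℕ, j ≤ n → volume {x ∈ X | |T j x| < w j} ≤ j * ENNReal.ofReal M := by
    intro j
    induction j with
    | zero =>
      intro _
      have : {x ∈ X | |T 0 x| < w 0} = ∅ := by
        ext x
        simp only [mem_ofPred_eq, mem_empty_iff_false, iff_false]
        rintro ⟨hx, h⟩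
        simp only [T, w, tailPart_zero, headWeight_zero] at h
        simp only [Nat.cast_zero, zero_div, Real.rpow_zero] at h
        exact absurd (hge x hx) (not_le.2 h)
      rw [this]; simp
    | succ j ih =>
      intro hj
      have hsub : {x ∈ X | |T (j + 1) x| < w (j + 1)} ⊆ {x ∈ X | |T j x| < w j} ∪
          {x ∈ X | w j ≤ |T j x| ∧ |T (j + 1) x| < w (j + 1)} := by
        rintro x ⟨hx, h⟩
        rcases lt_or_ge (|T j x|) (w j) with h' | h'
        · exact .inl ⟨hx, h'⟩
        · exact .inr ⟨hx, h', h⟩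
      refine (measure_mono hsub).trans ((measure_union_le _ _).trans ?_)
      rw [Nat.cast_add, Nat.cast_one, add_mul, one_mul]
      exact add_le_add (ih (by omega)) (hstep ⟨j, by omega⟩)
  have := hind n le_rfl
  simp only [T, w, tailPart_self, mderiv_zero, headWeight_self] at this
  rw [← hb, div_self hb0, Real.rpow_one] at this
  refine this.trans (le_of_eq ?_)
  rw [mul_assoc, mul_assoc, ENNReal.ofReal_mul (Nat.cast_nonneg _), ENNReal.ofReal_natCast, hM,
    mul_assoc]

/-! ### Estimates for the small and large parts of the phase derivative -/

theorem pderiv_sub_const (j : Fin n) (f : EuclideanSpace ℝ (Fin n) → ℝ) (c : ℝ) :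
    pderiv j (fun x => f x - c) = pderiv j f := by
  ext x
  simp only [pderiv, fderiv_sub_const]

theorem mderiv_sub_const {β : Fin n → ℕ} (hβ : β ≠ 0) (f : EuclideanSpace ℝ (Fin n) → ℝ) (c : ℝ) :
    mderiv β (fun x => f x - c) = mderiv β f := by
  have key : ∀ l : List (Fin n),
      l.foldr (fun j g => (pderiv j)^[β j] g) (fun x => f x - c) =
        l.foldr (fun j g => (pderiv j)^[β j] g) f ∨
      ((∀ i ∈ l, β i = 0) ∧ l.foldr (fun j g => (pderiv j)^[β j] g) (fun x => f x - c) =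
        fun x => l.foldr (fun j g => (pderiv j)^[β j] g) f x - c) := by
    intro l
    induction l with
    | nil => exact .inr ⟨by simp, rfl⟩
    | cons a l ih =>
      simp only [List.foldr_cons]
      rcases ih with h | ⟨h0, h⟩
      · exact .inl (by rw [h])
      · rw [h]
        rcases Nat.eq_zero_or_pos (β a) with ha | ha
        · exact .inr ⟨by simpa [ha] using h0, by simp [ha]⟩
        · obtain ⟨e, he⟩ := Nat.exists_eq_succ_of_ne_zero ha.ne'
          left
          rw [he, Function.iterate_succ_apply, Function.iterate_succ_apply, pderiv_sub_const]
  rcases key (List.finRange n) with h | ⟨h, -⟩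
  · exact h
  · exact absurd (funext fun i => h i (List.mem_finRange i)) hβ

/-- As `γ` vanishes after `k`, the extra `∂_k` joins the innermost derivatives already in direction
`k`; symmetry of mixed derivatives is not needed. -/
theorem mderiv_pderiv {γ γ' : Fin n → ℕ} {k : Fin n} (f : EuclideanSpace ℝ (Fin n) → ℝ)
    (hγ : ∀ i, k < i → γ i = 0) (h : ∀ i, i ≠ k → γ' i = γ i) (hk : γ' k = γ k + 1) :
    mderiv γ (pderiv k f) = mderiv γ' f := by
  have hzero : ∀ (l : List (Fin n)) (g : EuclideanSpace ℝ (Fin n) → ℝ) (δ : Fin n → ℕ),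
      (∀ i ∈ l, δ i = 0) → l.foldr (fun j g => (pderiv j)^[δ j] g) g = g := by
    intro l g δ
    induction l with
    | nil => intro _; rfl
    | cons a l ih =>
      intro h
      rw [List.foldr_cons, h a (by simp), Function.iterate_zero, id]
      exact ih fun i hi => h i (by simp [hi])
  have key : ∀ l : List (Fin n), l.Pairwise (· < ·) → k ∈ l →
      l.foldr (fun j g => (pderiv j)^[γ j] g) (pderiv k f) =
        l.foldr (fun j g => (pderiv j)^[γ' j] g) f := by
    intro l
    induction l with
    | nil => intro _ hk; simp at hk
    | cons a l ih =>
      intro hl hkl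
      rw [List.pairwise_cons] at hl
      simp only [List.foldr_cons]
      rcases List.mem_cons.1 hkl with rfl | hk'
      · rw [hzero l _ γ fun i hi => hγ i (hl.1 i hi), hzero l _ γ' fun i hi => by
          rw [h i (hl.1 i hi).ne', hγ i (hl.1 i hi)], hk, Function.iterate_succ_apply]
      · rw [ih hl.2 hk', h a (hl.1 k hk').ne]
  exact key _ (List.pairwise_lt_finRange n) (List.mem_finRange k)

/-- The hypotheses on the domain `X` and the function `f`, with `X` in a box of centre `x₀` and
side `2 D`. -/
structure Admissible (A : ℕ) (β N : Fin n → ℕ) (X U : Set (EuclideanSpace ℝ (Fin n)))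
    (f : EuclideanSpace ℝ (Fin n) → ℝ) (x₀ : Fin n → ℝ) (D : ℝ) : Prop where
  nullMeasurableSet : NullMeasurableSet X volume
  nonneg : 0 ≤ D
  abs_sub_le : ∀ x ∈ X, ∀ i, |x i - x₀ i| ≤ D
  slices : ∀ j : Fin n, (0 < (j : ℕ) ∨ 0 < β j) → SlicesIn j A X
  isOpen : IsOpen U
  subset : X ⊆ U
  contDiffOn : ContDiffOn ℝ ∞ f U
  one_le : ∀ x ∈ X, 1 ≤ |mderiv β f x|
  singleSignedOn : ∀ j : Fin n, (0 < (j : ℕ) ∨ β = Pi.single j 1) →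
    SingleSignedOn (mderiv (tailIndex β N j) f) X

theorem tailIndex_ne_zero {β N : Fin n → ℕ} {j : Fin n} (h : N j ≠ 0) : tailIndex β N j ≠ 0 :=
  fun h' => h (by simpa [tailIndex] using congrFun h' j)

theorem measure_abs_sub_lt_le (A : ℕ) (β N : Fin n → ℕ) (hβ : β ≠ 0)
    (hN : ∀ j : Fin n, (0 < (j : ℕ) ∨ β = Pi.single j 1) → β j < N j) : ∃ C : ℝ, 0 ≤ C ∧
    ∀ X U f x₀ D, Admissible A β N X U f x₀ D → ∀ c μ : ℝ, 0 < μ →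
      volume {x ∈ X | |f x - c| < μ ^ (∑ i, β i)} ≤
        ENNReal.ofReal (C * (2 * D) ^ (n - 1) * μ) := by
  obtain ⟨C, hC, H⟩ := sublevel_estimate A β N hβ fun j hj _ => hN j (.inl hj)
  refine ⟨C, hC, fun X U f x₀ D hf c μ hμ => ?_⟩
  have := H X U (fun x => f x - c) x₀ D hf.nullMeasurableSet hf.nonneg hf.abs_sub_le
    (fun j hj => hf.slices j (.inr (Nat.pos_of_ne_zero hj))) hf.isOpen hf.subset
    (hf.contDiffOn.sub contDiffOn_const)
    (by rw [mderiv_sub_const hβ]; exact hf.one_le)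
    (fun j hj _ => by
      rw [mderiv_sub_const (tailIndex_ne_zero (Nat.ne_zero_of_lt (hN j (.inl hj))))]
      exact hf.singleSignedOn j (.inl hj))
    (μ ^ (∑ i, β i)) (by positivity)
  rwa [one_div, Real.pow_rpow_inv_natCast hμ.le (sum_ne_zero hβ)] at this

/-- This is the sublevel estimate for `∂_k f` with both `β` and `N` lowered by one in position `k`.
The choice of `k` as the last active index turns each sign condition needed for `∂_k f` into one
assumed for `f`. -/
theorem measure_abs_pderiv_lt_le (A : ℕ) (β N : Fin n → ℕ) (k : Fin n) (hk : β k ≠ 0)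
    (hkl : ∀ i, k < i → β i = 0)
    (hN : ∀ j : Fin n, (0 < (j : ℕ) ∨ β = Pi.single j 1) → β j < N j) : ∃ C : ℝ, 0 ≤ C ∧
    ∀ X U f x₀ D, Admissible A β N X U f x₀ D → ∀ μ : ℝ, 0 < μ →
      volume {x ∈ X | |pderiv k f x| < μ ^ ((∑ i, β i) - 1)} ≤
        ENNReal.ofReal (C * (2 * D) ^ (n - 1) * μ) := by
  set β' : Fin n → ℕ := Function.update β k (β k - 1) with hβ'
  set N' : Fin n → ℕ := Function.update N k (N k - 1) with hN'
  have hkk : β' k = β k - 1 := by simp [hβ']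
  have hne : ∀ i, i ≠ k → β' i = β i := fun i hi => by simp [hβ', hi]
  have hle : ∀ i, β' i ≠ 0 → β i ≠ 0 := by
    intro i hi
    by_cases h : i = k
    · rw [h]; exact hk
    · rwa [← hne i h]
  have hsum : ∑ i, β i = ∑ i, β' i + 1 := by
    rw [← Finset.add_sum_erase _ β (Finset.mem_univ k),
      ← Finset.add_sum_erase _ β' (Finset.mem_univ k), hkk,
      Finset.sum_congr rfl fun i hi => hne i (Finset.ne_of_mem_erase hi)]
    have := Nat.pos_of_ne_zero hk
    change β k + ∑ x ∈ Finset.univ.erase k, β x = β k - 1 + ∑ x ∈ Finset.univ.erase k, β x + 1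
    omega
  have hmd : ∀ f, mderiv β' (pderiv k f) = mderiv β f := fun f =>
    mderiv_pderiv f (fun i hi => by rw [hne i hi.ne', hkl i hi]) (fun i hi => (hne i hi).symm)
      (by omega)
  -- If `∂^β = ∂_k`, the threshold is `μ^0 = 1` and the set is empty.
  by_cases h0 : β' = 0
  · refine ⟨0, le_rfl, fun X U f x₀ D hf μ hμ => ?_⟩
    have : {x ∈ X | |pderiv k f x| < μ ^ ((∑ i, β i) - 1)} = ∅ := by
      ext x
      simp only [mem_ofPred_eq, mem_empty_iff_false, iff_false]
      rintro ⟨hx, h⟩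
      have h1 := hf.one_le x hx
      rw [← hmd, h0, mderiv_zero] at h1
      rw [hsum, h0] at h
      simp only [Pi.zero_apply, Finset.sum_const_zero, zero_add, Nat.sub_self, pow_zero] at h
      linarith
    rw [this]; simp
  obtain ⟨C, hC, H⟩ := sublevel_estimate A β' N' h0 fun j hj hj0 => by
    have h1 := hN j (.inl hj)
    by_cases h : j = k
    · subst h
      rw [hkk]; simp only [hN', Function.update_self]; omega
    · rw [hne j h]; simpa [hN', h] using h1
  refine ⟨C, hC, fun X U f x₀ D hf μ hμ => ?_⟩
  have := H X U (pderiv k f) x₀ D hf.nullMeasurableSet hf.nonneg hf.abs_sub_le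
    (fun j hj => hf.slices j (.inr (Nat.pos_of_ne_zero (hle j hj)))) hf.isOpen hf.subset
    (contDiffOn_pderiv hf.isOpen hf.contDiffOn k) (by rw [hmd]; exact hf.one_le)
    (fun j hj hj0 => by
      have hjk : j ≤ k := by
        by_contra h
        exact hle j hj0 (hkl j (not_le.1 h))
      have h1 := hN j (.inl hj)
      rw [mderiv_pderiv (γ' := tailIndex β N j) f]
      · exact hf.singleSignedOn j (.inl hj)
      · intro i hi
        have : β' i = 0 := by rw [hne i hi.ne', hkl i hi]
        simp [tailIndex, (hjk.trans_lt hi).ne', this]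
      · intro i hi
        simp only [tailIndex]
        split_ifs with h2 h3
        · rfl
        · rw [hN', Function.update_of_ne (h3 ▸ hi)]
        · rw [hne i hi]
      · simp only [tailIndex]
        rw [if_neg (not_lt.2 hjk), if_neg (not_lt.2 hjk)]
        split_ifs with h3
        · rw [← h3, hN', h3, Function.update_self]
          subst h3
          omega
        · omega)
    (μ ^ (∑ i, β' i)) (by positivity)
  rw [one_div, Real.pow_rpow_inv_natCast hμ.le (sum_ne_zero h0)] at this
  rwa [hsum, Nat.add_sub_cancel]

theorem norm_setIntegral_exp_le (A m : ℕ) (β N : Fin n → ℕ) (k : Fin n) (hk : β k ≠ 0)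
    (hkl : ∀ i, k < i → β i = 0)
    (hN : ∀ j : Fin n, (0 < (j : ℕ) ∨ β = Pi.single j 1) → β j < N j) : ∃ C : ℝ, 0 ≤ C ∧
    ∀ X U f x₀ D, Admissible A β N X U f x₀ D → ∀ (P : Polynomial ℝ) (s η lam : ℝ),
      P.derivative.natDegree ≤ m → 0 < s → 0 < η → lam ≠ 0 →
      NullMeasurableSet {x ∈ X | η ≤ |pderiv k f x| ∧ s ≤ |P.derivative.eval (f x)|} volume ∧
      ‖∫ x in {x ∈ X | η ≤ |pderiv k f x| ∧ s ≤ |P.derivative.eval (f x)|},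
        Complex.exp (Complex.I * ((lam * P.eval (f x) : ℝ) : ℂ))‖ ≤
          C / (|lam| * s * η) * (2 * D) ^ (n - 1) := by
  classical
  -- The oscillatory estimate needs a single-signed derivative of order at least 2 in direction `k`.
  -- Either `N k > β k ≥ 1` provides it, or `k` is the first index and `β k ≥ 2`, and `|∂_k^(β k) f|
  -- ≥ 1` provides it. The excluded case `β = (1, 0, …, 0)` is the reason for the extra hypothesis
  -- on `N_1`.
  set N₀ : ℕ := if 0 < (k : ℕ) ∨ β = Pi.single k 1 then N k else β k with hN₀
  have htail : tailPart β (k + 1) = 0 := by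
    ext i
    simp only [tailPart, Pi.zero_apply, ite_eq_right_iff]
    exact fun h => hkl i (Fin.lt_def.2 h)
  have hN₀2 : 2 ≤ N₀ := by
    rw [hN₀]
    split_ifs with h
    · have := hN k h
      omega
    · by_contra hlt
      refine h (.inr (funext fun i => ?_))
      by_cases hi : i = k
      · subst hi; rw [Pi.single_eq_same]; omega
      · rw [Pi.single_eq_of_ne hi]
        refine hkl i (lt_of_le_of_ne (Fin.le_def.2 ?_) (Ne.symm hi))
        omega
  obtain ⟨C, hC, H⟩ := slice_oscillatory A N₀ m hN₀2
  refine ⟨C, hC, fun X U f x₀ D hf P s η lam hP hs hη hlam => ?_⟩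
  set X' := {x ∈ X | η ≤ |pderiv k f x| ∧ s ≤ |P.derivative.eval (f x)|} with hX'
  have hnull : NullMeasurableSet X' volume := by
    have := (nullMeasurableSet_le_abs hf.nullMeasurableSet hf.isOpen hf.subset
      (contDiffOn_pderiv hf.isOpen hf.contDiffOn k).continuousOn η).inter
      (nullMeasurableSet_le_abs hf.nullMeasurableSet hf.isOpen hf.subset
      (P.derivative.continuous.comp_continuousOn hf.contDiffOn.continuousOn) s)
    convert this using 1
    ext x
    simp only [hX', mem_ofPred_eq, mem_inter_iff, Function.comp]
    tauto
  refine ⟨hnull, ?_⟩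
  rw [← integral_indicator₀ hnull]
  refine norm_integral_le_of_slices k _ x₀ hf.nonneg
    (fun x hx => hf.abs_sub_le x (mem_of_indicator_ne_zero hx).1) fun x => ?_
  have hch := derivChainOn_slice hf.isOpen hf.subset hf.contDiffOn k x
  obtain ⟨hmeas, hle⟩ := H {t : ℝ | WithLp.toLp 2 (Function.update x k t) ∈ X} _
    (hf.slices k (.inr (Nat.pos_of_ne_zero hk)) x)
    ((Metric.isBounded_Icc (x₀ k - D) (x₀ k + D)).subset fun t ht => by
      have := abs_le.1 (hf.abs_sub_le _ ht k)
      simp only [Function.update_self] at this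
      exact ⟨by linarith [this.1], by linarith [this.2]⟩) hch
    (fun J hJS hJ => by
      by_cases h : 0 < (k : ℕ) ∨ β = Pi.single k 1
      · have h1 := hf.singleSignedOn k h
        rw [mderiv_tailIndex_eq, htail, mderiv_zero] at h1
        simp only [hN₀, if_pos h]
        exact h1.imp (fun H t ht => H _ (hJS ht)) (fun H t ht => H _ (hJS ht))
      · refine singleSignedOn_of_abs_pos hJ ((hch.mono hJS).continuousOn _) fun t ht => ?_
        have hk0 : (k : ℕ) = 0 := by omega
        have h1 := hf.one_le _ (hJS ht)
        have h2 := mderiv_tailPart_eq β f k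
        rw [htail, mderiv_zero, hk0, tailPart_zero] at h2
        rw [h2] at h1
        simp only [hN₀, if_neg h]
        linarith)
    P s η lam hP hs hη hlam
  rw [← integral_indicator hmeas] at hle
  exact hle

end PolyPhase

/-! ### Assembly of the theorem -/

open PolyPhase in
theorem theorem2p4 (n : ℕ) (hn : 2 ≤ n) (β : Fin n → ℕ) (hβ : β ≠ 0) (N : Fin n → ℕ)
    (hN : ∀ j : Fin n, (0 < (j : ℕ) ∨ β = Pi.single j 1) → β j < N j) (A d : ℕ) :
    ∃ C : ℝ → ℝ, (∀ R : ℝ, BddAbove (C '' Set.Icc 0 R)) ∧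
      ∀ X : Set (EuclideanSpace ℝ (Fin n)),
        Bornology.IsBounded X →
        MeasureTheory.NullMeasurableSet X MeasureTheory.volume →
        (∀ j : Fin n, (0 < (j : ℕ) ∨ 0 < β j) → PolyPhase.SlicesIn j A X) →
      ∀ (U : Set (EuclideanSpace ℝ (Fin n))) (f : EuclideanSpace ℝ (Fin n) → ℝ),
        IsOpen U → X ⊆ U → ContDiffOn ℝ ∞ f U →
        (∀ x ∈ X, 1 ≤ |PolyPhase.mderiv β f x|) →
        (∀ j : Fin n, (0 < (j : ℕ) ∨ β = Pi.single j 1) →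
          PolyPhase.SingleSignedOn (PolyPhase.mderiv (PolyPhase.tailIndex β N j) f) X) →
      ∀ P : Polynomial ℝ, P.natDegree = d →
        (P.derivative.Monic ∨ PolyPhase.IsSND P.derivative) →
      ∀ lam : ℝ, lam ≠ 0 →
        ‖∫ x in X, Complex.exp (Complex.I * ((lam * P.eval (f x) : ℝ) : ℂ))‖ ≤
          C (Metric.diam X) * |lam| ^ (-(1 / (((∑ i, β i : ℕ) : ℝ) * (d : ℝ)))) := by
  -- For `d = 0` the derivative is zero, which is neither monic nor SND.
  rcases d with _ | m
  · refine ⟨0, fun R => ⟨0, by rintro _ ⟨x, -, rfl⟩; simp⟩, ?_⟩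
    intro X _ _ _ U f _ _ _ _ _ P hP hP' lam _
    exfalso
    rw [Polynomial.eq_C_of_natDegree_eq_zero hP, Polynomial.derivative_C] at hP'
    rcases hP' with h | ⟨-, j, -, h⟩
    · exact zero_ne_one h
    · simp at h
  obtain ⟨k, hk, hkl⟩ : ∃ k : Fin n, β k ≠ 0 ∧ ∀ i, k < i → β i = 0 := by
    obtain ⟨i₀, hi₀⟩ := Function.ne_iff.1 hβ
    obtain ⟨k, hk, hmax⟩ := Finset.exists_max_image (Finset.univ.filter fun i => β i ≠ 0) id
      ⟨i₀, by simpa using hi₀⟩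
    refine ⟨k, by simpa using hk, fun i hi => ?_⟩
    by_contra h
    exact absurd (hmax i (by simpa using h)) (not_le.2 hi)
  obtain ⟨c, hc, hcQ⟩ := exists_le_abs_eval m
  obtain ⟨C₁, hC₁, H₁⟩ := measure_abs_sub_lt_le A β N hβ hN
  obtain ⟨C₂, hC₂, H₂⟩ := measure_abs_pderiv_lt_le A β N k hk hkl hN
  obtain ⟨C₃, hC₃, H₃⟩ := norm_setIntegral_exp_le A m β N k hk hkl hN
  set K : ℝ := C₃ / c + (C₂ + (2 ^ (m + 1) : ℕ) * C₁) with hK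
  have hK0 : 0 ≤ K := by positivity
  -- The first term covers `|λ| ≤ 1`, the second `|λ| > 1`.
  refine ⟨fun R => (2 * R) ^ n + K * (2 * R) ^ (n - 1), fun R => ?_, ?_⟩
  · refine isCompact_Icc.bddAbove_image (Continuous.continuousOn ?_)
    fun_prop
  intro X hXb hX hsl U f hU hXU hf hge hsgn P hP hP' lam hlam
  rcases X.eq_empty_or_nonempty with rfl | ⟨x₀, hx₀⟩
  · simp only [MeasureTheory.Measure.restrict_empty, MeasureTheory.integral_zero_measure, norm_zero,
      Metric.diam_empty]
    positivity
  set D := Metric.diam X with hD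
  have hD0 : 0 ≤ D := Metric.diam_nonneg
  have hadm : Admissible A β N X U f x₀ D :=
    ⟨hX, hD0, fun x hx i => by
      have h1 := PiLp.norm_apply_le (x - x₀) i
      rw [← dist_eq_norm] at h1
      exact h1.trans (Metric.dist_le_diam_of_mem hXb hx hx₀), hsl, hU, hXU, hf, hge, hsgn⟩
  set b := ∑ i, β i with hb
  have hb0 : b ≠ 0 := sum_ne_zero hβ
  have hlam0 : 0 < |lam| := abs_pos.2 hlam
  set μ : ℝ := |lam| ^ (-(1 / ((b : ℝ) * ((m + 1 : ℕ) : ℝ)))) with hμ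
  have hμ0 : 0 < μ := Real.rpow_pos_of_pos hlam0 _
  set e : EuclideanSpace ℝ (Fin n) → ℂ :=
    fun x => Complex.exp (Complex.I * ((lam * P.eval (f x) : ℝ) : ℂ)) with he
  have he1 : ∀ x, ‖e x‖ ≤ 1 := fun x => by
    simp only [he]; rw [mul_comm]; exact (Complex.norm_exp_ofReal_mul_I _).le
  have hfin : MeasureTheory.volume X < ⊤ := measure_lt_top_of_abs_sub_le hadm.abs_sub_le
  have hnorm : ∀ Y ⊆ X, ‖∫ x in Y, e x‖ ≤ MeasureTheory.volume.real Y := fun Y hY => by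
    simpa using MeasureTheory.norm_setIntegral_le_of_norm_le_const (C := 1)
      ((MeasureTheory.measure_mono hY).trans_lt hfin) fun x _ => he1 x
  rcases le_or_gt |lam| 1 with hl | hl
  · have h1 : 1 ≤ μ := Real.one_le_rpow_of_pos_of_le_one_of_nonpos hlam0 hl (by
      rw [neg_nonpos]; positivity)
    have h2 : MeasureTheory.volume.real X ≤ (2 * D) ^ n :=
      ENNReal.toReal_le_of_le_ofReal (by positivity)
        (measure_le_of_abs_sub_le k hX hD0 hadm.abs_sub_le)
    refine (hnorm X subset_rfl).trans (h2.trans ?_)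
    refine le_trans ?_ (le_mul_of_one_le_right (by positivity) h1)
    exact le_add_of_nonneg_right (by positivity)
  have hμ1 : μ ≤ 1 := Real.rpow_le_one_of_one_le_of_nonpos hl.le (by
      rw [neg_nonpos]; positivity)
  have hμpow : |lam| * μ ^ (b * (m + 1)) = 1 := by
    rw [hμ, ← Real.rpow_natCast, ← Real.rpow_mul hlam0.le]
    have : (b : ℝ) ≠ 0 := by exact_mod_cast hb0
    have h2 : -(1 / ((b : ℝ) * ((m + 1 : ℕ) : ℝ))) * ((b * (m + 1) : ℕ) : ℝ) = -1 := by
      push_cast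
      field_simp
    rw [h2, Real.rpow_neg_one, mul_inv_cancel₀ hlam0.ne']
  have hQd : P.derivative.natDegree = m := by
    rw [Polynomial.natDegree_derivative, hP, Nat.add_sub_cancel]
  -- With these thresholds the exponents add up to `b m + (b - 1) + 1 = b (m + 1)`, whence `|λ| s η
  -- μ = c`.
  set ε : ℝ := μ ^ b with hε
  have hε0 : 0 < ε := by positivity
  have hε1 : ε ≤ 1 := pow_le_one₀ hμ0.le hμ1
  set s : ℝ := c * ε ^ m with hs
  have hs0 : 0 < s := by positivity
  set η : ℝ := μ ^ (b - 1) with hη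
  have hη0 : 0 < η := by positivity
  obtain ⟨hX', hI⟩ := H₃ X U f x₀ D hadm P s η lam hQd.le hs0 hη0 hlam
  set X' := {x ∈ X | η ≤ |pderiv k f x| ∧ s ≤ |P.derivative.eval (f x)|} with hX'def
  have hprod : |lam| * s * η * μ = c := by
    have h1 : ε ^ m * η * μ = μ ^ (b * (m + 1)) := by
      rw [hε, hη, ← pow_mul, mul_assoc, ← pow_succ, ← pow_add]
      congr 1
      rw [Nat.sub_add_cancel (Nat.one_le_iff_ne_zero.2 hb0)]
      ring
    calc _ = c * (|lam| * (ε ^ m * η * μ)) := by rw [hs]; ring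
      _ = c := by rw [h1, hμpow, mul_one]
  have hdiv : C₃ / (|lam| * s * η) = C₃ / c * μ := by
    rw [← hprod]; field_simp
  have hbad : MeasureTheory.volume (X \ X') ≤
      ENNReal.ofReal ((C₂ + (2 ^ (m + 1) : ℕ) * C₁) * (2 * D) ^ (n - 1) * μ) := by
    have hsub : X \ X' ⊆ {x ∈ X | |pderiv k f x| < η} ∪
        (X ∩ f ⁻¹' {t | |P.derivative.eval t| < s}) := by
      rintro x ⟨hx, hx'⟩
      by_cases h : |pderiv k f x| < η
      · exact .inl ⟨hx, h⟩
      · refine .inr ⟨hx, ?_⟩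
        by_contra h'
        exact hx' ⟨hx, not_lt.1 h, not_lt.1 h'⟩
    have hB := (decomp_polynomial_abs_lt hQd.le s).measure_le (μ := MeasureTheory.volume)
      (φ := f) (Y := X) (M := ENNReal.ofReal (C₁ * (2 * D) ^ (n - 1) * μ)) fun T _ hT hTs => by
        rcases T.eq_empty_or_nonempty with rfl | ⟨t₀, ht₀⟩
        · simp
        refine (MeasureTheory.measure_mono ?_).trans (H₁ X U f x₀ D hadm t₀ μ hμ0)
        -- Two points of the interval `T` at distance at least `ε` would force `T` to contain a
        -- point where `|Q| ≥ s`.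
        have hshort : ∀ x ∈ T, ∀ y ∈ T, y < x + ε := by
          intro x hx y hy
          by_contra! h
          obtain ⟨t, ht, hle⟩ := hcQ P.derivative hQd hP' ε hε0 hε1 x
          exact absurd (hTs t (hT.out hx hy ⟨ht.1, ht.2.trans h⟩)) (not_lt.2 hle)
        rintro x ⟨hx, hxT⟩
        refine ⟨hx, abs_lt.2 ⟨?_, ?_⟩⟩
        · have := hshort _ hxT _ ht₀
          simp only [← hε]
          linarith
        · have := hshort _ ht₀ _ hxT
          simp only [← hε]
          linarith
    refine (MeasureTheory.measure_mono hsub).trans ((MeasureTheory.measure_union_le _ _).trans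
      ((add_le_add (H₂ X U f x₀ D hadm μ hμ0) hB).trans (le_of_eq ?_)))
    rw [← ENNReal.ofReal_natCast, ← ENNReal.ofReal_mul (by positivity),
      ← ENNReal.ofReal_add (by positivity) (by positivity)]
    congr 1
    ring
  have hcont : ContinuousOn e U :=
    Complex.continuous_exp.comp_continuousOn (continuousOn_const.mul
      (Complex.continuous_ofReal.comp_continuousOn (continuousOn_const.mul
        (P.continuous.comp_continuousOn hf.continuousOn))))
  have hInt : MeasureTheory.IntegrableOn e X := by
    refine MeasureTheory.IntegrableOn.of_bound hfin ?_ 1 (Filter.Eventually.of_forall he1)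
    exact (hcont.aestronglyMeasurable hU.measurableSet).mono_measure
      (MeasureTheory.Measure.restrict_mono hXU le_rfl)
  have hXX' : X' ⊆ X := fun x hx => hx.1
  have hsplit := MeasureTheory.integral_inter_add_sdiff₀ hX' hInt
  rw [Set.inter_eq_self_of_subset_right hXX'] at hsplit
  change ‖∫ x in X, e x‖ ≤ _
  rw [← hsplit]
  have hbad' : ‖∫ x in X \ X', e x‖ ≤ (C₂ + (2 ^ (m + 1) : ℕ) * C₁) * (2 * D) ^ (n - 1) * μ :=
    (hnorm _ Set.sdiff_subset).trans (ENNReal.toReal_le_of_le_ofReal (by positivity) hbad)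
  rw [hdiv] at hI
  refine (norm_add_le _ _).trans ((add_le_add hI hbad').trans ?_)
  have hrest : 0 ≤ (2 * D) ^ n * μ := by positivity
  calc _ = K * (2 * D) ^ (n - 1) * μ := by rw [hK]; ring
    _ ≤ _ := by rw [add_mul]; linarith
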